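/- Say that a set of points in the plane is in *c.s.c. position* if it is contained in the boundary of a centrally symmetric convex body (a compact convex set with nonempty interior that is symmetric about some point). Let $\Gamma$ be a simple closed curve in the plane such that every $6$ points of $\Gamma$ are in c.s.c. position. Then $\Gamma$ bounds a centrally symmetric convex region, that is, $\Gamma$ is the boundary of a centrally symmetric convex body. Moreover, $6$ is the least number with this property (for curves the Helly number is $6$): for every integer $0\le k<6$ there is a simple closed curve $\Gamma$ in the plane such that every $k$ points of $\Gamma$ are in c.s.c. position but $\Gamma$ does not bound a centrally symmetric convex region. -/

import Mathlib

/-- The Euclidean plane. -/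
abbrev Plane : Type := EuclideanSpace ℝ (Fin 2)

/-- `K` is a centrally symmetric convex body in the plane: a compact convex set with nonempty
interior that is mapped into itself (hence onto itself) by the reflection `x ↦ 2 o - x` in some
point `o`. -/
def IsCSCBody (K : Set Plane) : Prop :=
  IsCompact K ∧ Convex ℝ K ∧ (interior K).Nonempty ∧
    ∃ o : Plane, ∀ x ∈ K, (2 : ℝ) • o - x ∈ K

/-- `X` is in centrally symmetric convex position: it is contained in the boundary of a
centrally symmetric convex body. -/
def InCSCPosition (X : Set Plane) : Prop :=
  ∃ K : Set Plane, IsCSCBody K ∧ X ⊆ frontier K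

/-- Every `k` distinct points of `X` are in centrally symmetric convex position. -/
def EveryInCSCPosition (k : ℕ) (X : Set Plane) : Prop :=
  ∀ Y : Finset Plane, (Y : Set Plane) ⊆ X → Y.card = k → InCSCPosition (Y : Set Plane)

/-- `Γ` is a (simple) closed curve: the image of the unit circle under a continuous injective
map into the plane. -/
def IsClosedCurve (Γ : Set Plane) : Prop :=
  ∃ γ : Circle → Plane, Continuous γ ∧ Function.Injective γ ∧ Set.range γ = Γ

/-- `Γ` bounds a centrally symmetric convex region: it is the whole boundary of a centrally
symmetric convex body. -/
def BoundsCSCRegion (Γ : Set Plane) : Prop :=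
  ∃ K : Set Plane, IsCSCBody K ∧ frontier K = Γ

/-! Convexity first. If a point `P` of the curve were interior to the convex hull, a Carathéodory
argument on at most five points would give, opposite every point of the curve as seen from `P`,
another one on the same line. Two such pairs in independent directions surround `P`, and these five
points cannot lie on the boundary of a convex body (`subset_frontier_convexHull`). A closed curve
contained in the boundary of a planar convex set with interior is all of it, since otherwise the
curve would embed in a line (`IsClosedCurve.eq_frontier`).

Symmetry next. Let `M` be the support function of the resulting body `Q`, and `G f = M f - M (-f)`.
This `G` is odd and homogeneous, and `Q` is symmetric once `G` is linear, for which it suffices that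
`G` has nonnegative sum on every triple of functionals adding up to zero
(`exists_center_of_forall_sum_nonneg`). If some triple has negative sum, there is a point `c` lying,
in each of the three strips bounding `Q`, closer to the upper line than to the lower one. The chords
through `c` from three contact points `P i` on the lower lines are then longer on the side of `P i`,
and `c` is inside the triangle of the `P i`. A centre `o` of a symmetric body through the six chord
ends would have to be displaced from `c` away from all three supporting lines at the short ends,
which is impossible (`not_inCSCPosition_of_chords`).

Sharpness. Five points in strictly convex position lie on a conic. An ellipse is itself the boundary
of a symmetric body; on a parabola or a hyperbola branch the lens cut out by the curve and its
reflection in the midpoint of the two extreme points serves; degenerate conics, and points on both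
branches, are excluded by convex independence. So every strictly convex curve passes the five-point
test, for instance half a circle glued to half an ellipse, which has no centre. -/

/-! ### Passing to smaller point sets -/

theorem InCSCPosition.mono {X Y : Set Plane} (h : InCSCPosition Y) (hXY : X ⊆ Y) :
    InCSCPosition X := by
  obtain ⟨K, hK, hY⟩ := h
  exact ⟨K, hK, hXY.trans hY⟩

theorem Set.Infinite.exists_finset_superset_card_eq {α : Type*} {X : Set α} (hX : X.Infinite)
    {Y : Finset α} (hY : (Y : Set α) ⊆ X) {n : ℕ} (hn : Y.card ≤ n) :
    ∃ Z : Finset α, Y ⊆ Z ∧ (Z : Set α) ⊆ X ∧ Z.card = n := by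
  classical
  induction n, hn using Nat.le_induction with
  | base => exact ⟨Y, subset_rfl, hY, rfl⟩
  | succ n _ ih =>
    obtain ⟨Z, hYZ, hZX, hZ⟩ := ih
    obtain ⟨x, hx, hxZ⟩ := hX.exists_notMem_finset Z
    refine ⟨insert x Z, hYZ.trans (Finset.subset_insert _ _), ?_, ?_⟩
    · rw [Finset.coe_insert]; exact Set.insert_subset hx hZX
    · rw [Finset.card_insert_of_notMem hxZ, hZ]

/-- The definition asks for exactly `n` points; in an infinite set a smaller subset can be padded up
to `n`. -/
theorem EveryInCSCPosition.of_card_le {n : ℕ} {X : Set Plane} (hX : X.Infinite)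
    (h : EveryInCSCPosition n X) (Y : Finset Plane) (hY : (Y : Set Plane) ⊆ X)
    (hcard : Y.card ≤ n) : InCSCPosition (Y : Set Plane) := by
  obtain ⟨Z, hYZ, hZX, hZ⟩ := hX.exists_finset_superset_card_eq hY hcard
  exact (h Z hZX hZ).mono (by exact_mod_cast hYZ)

/-! ### Closed curves do not embed in a line -/

/-- One-dimensional Borsuk–Ulam: `h z - h (-z)` is odd, hence vanishes somewhere. -/
theorem Circle.not_injective_of_continuous {h : Circle → ℝ} (hc : Continuous h) :
    ¬ Function.Injective h := by
  intro hi
  have hcn : Continuous fun z : Circle => h z - h (-z) := by fun_prop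
  obtain ⟨z, hz⟩ : ∃ z, (fun z : Circle => h z - h (-z)) z = 0 := by
    have h1 : -(h 1 - h (-1)) = h (-1) - h (- -1) := by simp
    rcases le_total (h 1 - h (-1)) 0 with h0 | h0
    · exact mem_range_of_exists_le_of_exists_ge hcn ⟨1, h0⟩ ⟨-1, by simpa using h0⟩
    · exact mem_range_of_exists_le_of_exists_ge hcn ⟨-1, by simpa using h0⟩ ⟨1, h0⟩
  have h2 : z = -z := hi (sub_eq_zero.1 hz)
  have h3 : (z : ℂ) = -(z : ℂ) := congrArg Subtype.val h2
  have h4 : (z : ℂ) = 0 := by linear_combination h3 / 2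
  exact z.coe_ne_zero h4

theorem IsClosedCurve.infinite {Γ : Set Plane} (h : IsClosedCurve Γ) : Γ.Infinite := by
  obtain ⟨γ, -, hi, rfl⟩ := h
  have : Infinite (Set.Ioc (-Real.pi) Real.pi) :=
    (Set.Ioc_infinite (by linarith [Real.pi_pos])).to_subtype
  have : Infinite Circle := Infinite.of_injective _ Circle.argEquiv.symm.injective
  exact Set.infinite_range_of_injective hi

theorem IsClosedCurve.isCompact {Γ : Set Plane} (h : IsClosedCurve Γ) : IsCompact Γ := by
  obtain ⟨γ, hc, -, rfl⟩ := h
  exact isCompact_range hc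

theorem IsClosedCurve.not_injOn {Γ : Set Plane} (h : IsClosedCurve Γ) {f : Plane → ℝ}
    (hf : ContinuousOn f Γ) : ¬ Set.InjOn f Γ := by
  obtain ⟨γ, hc, hi, rfl⟩ := h
  intro hinj
  refine Circle.not_injective_of_continuous (h := f ∘ γ) ?_ ?_
  · exact hf.comp_continuous hc fun z => ⟨z, rfl⟩
  · intro a b hab
    exact hi (hinj ⟨a, rfl⟩ ⟨b, rfl⟩ hab)

/-! ### Linear functionals and supporting lines in the plane -/

theorem Plane.apply_eq (g : Plane →L[ℝ] ℝ) (x : Plane) :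
    g x = x 0 * g (EuclideanSpace.single 0 1) + x 1 * g (EuclideanSpace.single 1 1) := by
  have hx : x = x 0 • EuclideanSpace.single 0 (1 : ℝ) + x 1 • EuclideanSpace.single 1 (1 : ℝ) := by
    ext i; fin_cases i <;> simp
  conv_lhs => rw [hx]
  simp

theorem Plane.exists_eq_smul {g : Plane →L[ℝ] ℝ} (hg : g ≠ 0) {u z : Plane} (hu : u ≠ 0)
    (hgu : g u = 0) (hgz : g z = 0) : ∃ s : ℝ, z = s • u := by
  rw [Plane.apply_eq] at hgu hgz
  set a := g (EuclideanSpace.single 0 1) with ha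
  set b := g (EuclideanSpace.single 1 1) with hb
  have hab : a ≠ 0 ∨ b ≠ 0 := by
    by_contra! h
    apply hg
    ext x
    rw [Plane.apply_eq, ← ha, ← hb, h.1, h.2]; simp
  have hdet : z 0 * u 1 = z 1 * u 0 := by
    rcases hab with h | h
    · apply mul_left_cancel₀ h; linear_combination u 1 * hgz - z 1 * hgu
    · apply mul_left_cancel₀ h; linear_combination -u 0 * hgz + z 0 * hgu
  have hu' : u 0 ≠ 0 ∨ u 1 ≠ 0 := by
    by_contra! h
    apply hu
    ext i; fin_cases i
    · exact h.1
    · exact h.2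
  rcases hu' with h | h
  · refine ⟨z 0 / u 0, ?_⟩
    ext i; fin_cases i
    · simp [h]
    · simp; field_simp; linarith
  · refine ⟨z 1 / u 1, ?_⟩
    ext i; fin_cases i
    · simp; field_simp; linarith
    · simp [h]

theorem exists_lt_apply_of_mem_interior {Q : Set Plane} {P : Plane} (hP : P ∈ interior Q)
    {g : Plane →L[ℝ] ℝ} (hg : g ≠ 0) : ∃ x ∈ Q, g P < g x := by
  obtain ⟨v, hv⟩ : ∃ v, 0 < g v := by
    obtain ⟨v, hv⟩ : ∃ v, g v ≠ 0 := by
      by_contra! h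
      exact hg (by ext x; simp [h])
    rcases hv.lt_or_gt with h | h
    · exact ⟨-v, by simpa using h⟩
    · exact ⟨v, h⟩
  have hcont : Filter.Tendsto (fun ε : ℝ => P + ε • v) (nhdsWithin 0 (Set.Ioi 0)) (nhds P) := by
    have : Continuous fun ε : ℝ => P + ε • v := by fun_prop
    simpa using (this.tendsto 0).mono_left nhdsWithin_le_nhds
  obtain ⟨ε, h1, h2⟩ := ((hcont.eventually (mem_interior_iff_mem_nhds.1 hP)).and
    self_mem_nhdsWithin).exists
  refine ⟨_, h1, ?_⟩
  have : 0 < ε * g v := mul_pos h2 hv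
  simpa using this

theorem exists_lt_apply_of_mem_interior_convexHull {Γ : Set Plane} {P : Plane}
    (hP : P ∈ interior (convexHull ℝ Γ)) {g : Plane →L[ℝ] ℝ} (hg : g ≠ 0) :
    ∃ x ∈ Γ, g P < g x := by
  by_contra! h
  obtain ⟨x, hx, hlt⟩ := exists_lt_apply_of_mem_interior hP hg
  have hsub : convexHull ℝ Γ ⊆ {x | g x ≤ g P} :=
    convexHull_min h (convex_halfSpace_le g.isLinear _)
  exact absurd (hsub hx) (not_le.2 hlt)

theorem exists_support_of_mem_frontier {K : Set Plane} (hK : Convex ℝ K)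
    (hi : (interior K).Nonempty) {R : Plane} (hR : R ∈ frontier K) :
    ∃ g : Plane →L[ℝ] ℝ, g ≠ 0 ∧ (∀ x ∈ K, g x ≤ g R) ∧ ∀ x ∈ interior K, g x < g R := by
  obtain ⟨g, hg⟩ := geometric_hahn_banach_open_point hK.interior isOpen_interior hR.2
  refine ⟨g, ?_, ?_, hg⟩
  · rintro rfl
    obtain ⟨x, hx⟩ := hi
    simpa using hg x hx
  · intro x hx
    have hx' : x ∈ closure (interior K) := by
      rw [hK.closure_interior_eq_closure_of_nonempty_interior hi]; exact subset_closure hx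
    exact closure_minimal (t := {x | g x ≤ g R}) (fun y hy => (hg y hy).le)
      (isClosed_le g.continuous continuous_const) hx'

theorem mem_frontier_of_support {K : Set Plane} {R : Plane} (hR : R ∈ K) {g : Plane →L[ℝ] ℝ}
    (hg : g ≠ 0) (h : ∀ x ∈ K, g x ≤ g R) : R ∈ frontier K := by
  refine ⟨subset_closure hR, fun hi => ?_⟩
  obtain ⟨x, hx, hlt⟩ := exists_lt_apply_of_mem_interior hi hg
  exact absurd (h x hx) (not_le.2 hlt)

theorem exists_apply_eq_of_interior_convexHull_eq_empty {S : Set Plane} (hS : S.Nonempty)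
    (h : interior (convexHull ℝ S) = ∅) :
    ∃ f : Plane →L[ℝ] ℝ, f ≠ 0 ∧ ∀ x ∈ S, ∀ y ∈ S, f x = f y := by
  have hne : ¬ affineSpan ℝ S = ⊤ := fun htop =>
    (interior_convexHull_nonempty_iff_affineSpan_eq_top.2 htop).ne_empty h
  have hdir : (affineSpan ℝ S).direction < ⊤ := by
    rw [lt_top_iff_ne_top]
    intro htop
    exact hne ((AffineSubspace.direction_eq_top_iff_of_nonempty (hS.affineSpan ℝ)).1 htop)
  obtain ⟨f, hf, hker⟩ := Submodule.exists_le_ker_of_lt_top _ hdir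
  refine ⟨f.toContinuousLinearMap, by simpa using hf, fun x hx y hy => ?_⟩
  rw [← sub_eq_zero, ← map_sub]
  exact hker
    (AffineSubspace.vsub_mem_direction (subset_affineSpan ℝ S hx) (subset_affineSpan ℝ S hy))

theorem IsClosedCurve.interior_convexHull_nonempty {Γ : Set Plane} (h : IsClosedCurve Γ) :
    (interior (convexHull ℝ Γ)).Nonempty := by
  by_contra hne
  obtain ⟨p, hp⟩ := h.infinite.nonempty
  obtain ⟨f, hf, hconst⟩ := exists_apply_eq_of_interior_convexHull_eq_empty ⟨p, hp⟩
    (Set.not_nonempty_iff_eq_empty.1 hne)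
  obtain ⟨q, hq, hqp⟩ := h.infinite.nontrivial.exists_ne p
  refine h.not_injOn (f := fun x => inner ℝ (q - p) x) (by fun_prop) ?_
  intro x hx y hy hxy
  obtain ⟨s, hs⟩ := Plane.exists_eq_smul (z := x - y) hf (sub_ne_zero.2 hqp)
    (by rw [map_sub, hconst q hq p hp, sub_self]) (by rw [map_sub, hconst x hx y hy, sub_self])
  have h0 : inner ℝ (q - p) (x - y) = 0 := by
    rw [inner_sub_right]; exact sub_eq_zero.2 hxy
  rw [hs, inner_smul_right, real_inner_self_eq_norm_sq] at h0
  have hn : ‖q - p‖ ^ 2 ≠ 0 := by simpa using sub_ne_zero.2 hqp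
  have : s = 0 := by simpa [hn] using h0
  rw [this, zero_smul] at hs
  exact sub_eq_zero.1 hs

/-! ### The curve lies on the boundary of its convex hull -/

/-- A point slightly beyond `P` on the line from `A` is a positive combination of at most three
points of `Γ`. A line supporting `P`, `A` and these at `P` must contain them all, so one of them is
beyond `P`. -/
theorem exists_mem_opposite_ray {Γ : Set Plane} (hinf : Γ.Infinite)
    (h6 : EveryInCSCPosition 6 Γ) {P : Plane} (hP : P ∈ Γ)
    (hPi : P ∈ interior (convexHull ℝ Γ)) {A : Plane} (hA : A ∈ Γ) (hAP : A ≠ P) :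
    ∃ C ∈ Γ, ∃ s : ℝ, 0 < s ∧ C - P = -(s • (A - P)) := by
  classical
  obtain ⟨ε, hεQ, hε⟩ : ∃ ε : ℝ, P + ε • (P - A) ∈ convexHull ℝ Γ ∧ 0 < ε := by
    have hcont : Filter.Tendsto (fun ε : ℝ => P + ε • (P - A)) (nhdsWithin 0 (Set.Ioi 0))
        (nhds P) := by
      have : Continuous fun ε : ℝ => P + ε • (P - A) := by fun_prop
      simpa using (this.tendsto 0).mono_left nhdsWithin_le_nhds
    exact ((hcont.eventually (mem_interior_iff_mem_nhds.1 hPi)).and self_mem_nhdsWithin).exists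
  obtain ⟨ι, _, z, w, hz, hind, hw, hw1, hB⟩ := eq_pos_convex_span_of_mem_convexHull hεQ
  have hcard : Fintype.card ι ≤ 3 := by
    have h1 := hind.card_le_finrank_succ
    have h2 := (vectorSpan ℝ (Set.range z)).finrank_le
    have h3 : Module.finrank ℝ Plane = 2 := by simp
    omega
  set Y : Finset Plane := insert P (insert A (Finset.univ.image z)) with hY
  have hYΓ : (Y : Set Plane) ⊆ Γ := by
    intro x hx
    simp only [hY, Finset.coe_insert, Finset.coe_image, Finset.coe_univ, Set.image_univ,
      Set.mem_insert_iff] at hx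
    rcases hx with rfl | rfl | hx
    exacts [hP, hA, hz hx]
  have hYcard : Y.card ≤ 6 := by
    have h1 := Finset.card_insert_le P (insert A (Finset.univ.image z))
    have h2 := Finset.card_insert_le A (Finset.univ.image z)
    have h3 : (Finset.univ.image z).card ≤ Fintype.card ι := Finset.card_image_le
    rw [hY]; omega
  obtain ⟨K, ⟨hKc, hKconv, hKi, -⟩, hYK⟩ := h6.of_card_le hinf Y hYΓ hYcard
  obtain ⟨g, hg0, hg, -⟩ := exists_support_of_mem_frontier hKconv hKi
    (hYK (show P ∈ (Y : Set Plane) by simp [hY]))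
  have hYg : ∀ x ∈ Y, g (x - P) ≤ 0 := fun x hx => by
    rw [map_sub, sub_nonpos]; exact hg x (hKc.isClosed.frontier_subset (hYK hx))
  have hgA : g (A - P) ≤ 0 := hYg A (by simp [hY])
  have hgz : ∀ i, g (z i - P) ≤ 0 := fun i => hYg _ (by simp [hY])
  have hBv : ∑ i, w i • (z i - P) = ε • (P - A) := by
    simp only [smul_sub, Finset.sum_sub_distrib, hB, ← Finset.sum_smul, hw1, one_smul]
    abel
  have hBg : ∑ i, w i * g (z i - P) = -(ε * g (A - P)) := by
    have := congrArg g hBv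
    rw [map_sum] at this
    simp only [map_smul, smul_eq_mul] at this
    rw [this, ← neg_sub A P, map_neg]; ring
  have hterm : ∀ i ∈ Finset.univ, w i * g (z i - P) ≤ 0 := fun i _ =>
    mul_nonpos_of_nonneg_of_nonpos (hw i).le (hgz i)
  have hsum : ∑ i, w i * g (z i - P) = 0 :=
    -- The sum is `≤ 0` term by term, and `≥ 0` because it equals `-(ε * g (A - P))`; hence every
    -- term vanishes.
    le_antisymm (Finset.sum_nonpos hterm) (by rw [hBg]; nlinarith)
  have hgA0 : g (A - P) = 0 := by
    rw [hsum] at hBg; nlinarith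
  have hgz0 : ∀ i, g (z i - P) = 0 := fun i => by
    have := (Finset.sum_eq_zero_iff_of_nonpos hterm).1 hsum i (Finset.mem_univ i)
    simpa [(hw i).ne'] using this
  choose s hs using fun i => Plane.exists_eq_smul hg0 (sub_ne_zero.2 hAP) hgA0 (hgz0 i)
  have hws : (∑ i, w i * s i) = -ε := by
    have h1 : (∑ i, w i * s i + ε) • (A - P) = 0 := by
      rw [add_smul, Finset.sum_smul]
      simp only [mul_smul, ← hs, hBv]
      rw [← smul_add]; simp
    rcases smul_eq_zero.1 h1 with h | h
    · linarith
    · exact absurd h (sub_ne_zero.2 hAP)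
  obtain ⟨i, hi⟩ : ∃ i, s i < 0 := by
    by_contra! h
    have := Finset.sum_nonneg fun i (_ : i ∈ Finset.univ) => mul_nonneg (hw i).le (h i)
    linarith
  exact ⟨z i, hz ⟨i, rfl⟩, -s i, by linarith, by rw [hs i]; simp⟩

theorem subset_frontier_convexHull {Γ : Set Plane} (hinf : Γ.Infinite)
    (h6 : EveryInCSCPosition 6 Γ) : Γ ⊆ frontier (convexHull ℝ Γ) := by
  classical
  intro P hP
  refine ⟨subset_closure (subset_convexHull ℝ Γ hP), fun hPi => ?_⟩
  obtain ⟨A, hA, hAP⟩ := hinf.nontrivial.exists_ne P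
  obtain ⟨C, hC, s, hs, hCA⟩ := exists_mem_opposite_ray hinf h6 hP hPi hA hAP
  -- A point with `n` strictly larger than at `P` is off the line through `A` and `P`, giving the
  -- second direction.
  obtain ⟨n, hn0, hnA⟩ : ∃ n : Plane →L[ℝ] ℝ, n ≠ 0 ∧ n (A - P) = 0 := by
    refine ⟨(A - P) 1 • EuclideanSpace.proj 0 - (A - P) 0 • EuclideanSpace.proj 1, ?_, ?_⟩
    · intro h
      apply hAP
      have h0 := DFunLike.congr_fun h (EuclideanSpace.single 0 1)
      have h1 := DFunLike.congr_fun h (EuclideanSpace.single 1 1)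
      ext i; fin_cases i
      · exact (by simpa [sub_eq_zero] using h1 : P 0 = A 0).symm
      · simpa [sub_eq_zero] using h0
    · simp; ring
  obtain ⟨A', hA', hnA'⟩ := exists_lt_apply_of_mem_interior_convexHull hPi hn0
  have hA'P : A' ≠ P := by rintro rfl; exact lt_irrefl _ hnA'
  obtain ⟨C', hC', s', hs', hCA'⟩ := exists_mem_opposite_ray hinf h6 hP hPi hA' hA'P
  set Y : Finset Plane := {P, A, C, A', C'} with hY
  have hYΓ : (Y : Set Plane) ⊆ Γ := by
    intro x hx
    simp only [hY, Finset.coe_insert, Finset.coe_singleton, Set.mem_insert_iff,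
      Set.mem_singleton_iff] at hx
    rcases hx with rfl | rfl | rfl | rfl | rfl <;> assumption
  obtain ⟨K, ⟨hKc, hKconv, hKi, -⟩, hYK⟩ :=
    h6.of_card_le hinf Y hYΓ (Finset.card_le_five.trans (by norm_num))
  obtain ⟨g, hg0, hg, -⟩ := exists_support_of_mem_frontier hKconv hKi
    (hYK (show P ∈ (Y : Set Plane) by simp [hY]))
  have hYg : ∀ x ∈ Y, g (x - P) ≤ 0 := fun x hx => by
    rw [map_sub, sub_nonpos]; exact hg x (hKc.isClosed.frontier_subset (hYK hx))
  have key : ∀ {B D : Plane} {r : ℝ}, B ∈ Y → D ∈ Y → 0 < r → D - P = -(r • (B - P)) →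
      g (B - P) = 0 := by
    intro B D r hB hD hr hDB
    have h1 := hYg B hB
    have h2 := hYg D hD
    rw [hDB, map_neg, map_smul, smul_eq_mul] at h2
    nlinarith
  have hgA := key (by simp [hY]) (by simp [hY]) hs hCA
  have hgA' := key (by simp [hY]) (by simp [hY]) hs' hCA'
  obtain ⟨r, hr⟩ := Plane.exists_eq_smul hg0 (sub_ne_zero.2 hAP) hgA hgA'
  have : n (A' - P) = 0 := by rw [hr, map_smul, hnA, smul_zero]
  rw [map_sub] at this
  linarith

/-! ### A closed curve on a convex boundary fills it -/

/-- The open segment from an interior point to a point of the closure is interior, so a ray from `c`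
meets the frontier at most once. -/
theorem Convex.eq_of_sameRay_of_mem_frontier {Q : Set Plane} (hQ : Convex ℝ Q) {c x y : Plane}
    (hc : c ∈ interior Q) (hx : x ∈ frontier Q) (hy : y ∈ frontier Q) {r : ℝ} (hr : 0 < r)
    (h : y - c = r • (x - c)) : y = x := by
  have key : ∀ {u v : Plane} {t : ℝ}, u ∈ frontier Q → v ∈ frontier Q → 0 < t → t < 1 →
      v - c = t • (u - c) → False := by
    intro u v t hu hv ht ht1 huv
    refine hv.2 (hQ.openSegment_interior_closure_subset_interior hc hu.1
      ⟨1 - t, t, by linarith, ht, by ring, ?_⟩)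
    rw [← sub_add_cancel v c, huv]; module
  rcases lt_trichotomy r 1 with h1 | rfl | h1
  · exact (key hx hy hr h1 h).elim
  · simpa using h
  · refine (key hy hx (inv_pos.2 hr) (inv_lt_one_of_one_lt₀ h1) ?_).elim
    rw [h, smul_smul, inv_mul_cancel₀ hr.ne', one_smul]

theorem IsClosedCurve.eq_frontier {Γ Q : Set Plane} (h : IsClosedCurve Γ) (hQ : Convex ℝ Q)
    (hQi : (interior Q).Nonempty) (hΓ : Γ ⊆ frontier Q) : Γ = frontier Q := by
  refine hΓ.antisymm fun p hp => ?_
  by_contra hpΓ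
  obtain ⟨c, hc⟩ := hQi
  have hne : ∀ x ∈ frontier Q, x ≠ c := by rintro x hx rfl; exact hx.2 hc
  let e : Plane →L[ℝ] ℂ := (Complex.orthonormalBasisOneI.repr.symm : Plane →L[ℝ] ℂ)
  have he : Function.Injective e := Complex.orthonormalBasisOneI.repr.symm.injective
  have hpc : e (p - c) ≠ 0 := fun h0 =>
    hne p hp (sub_eq_zero.1 (he (by rw [h0, map_zero])))
  have hnz : ∀ x ∈ frontier Q, -(e (x - c) / e (p - c)) ≠ 0 := fun x hx h0 => by
    rw [neg_eq_zero, div_eq_zero_iff] at h0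
    rcases h0 with h0 | h0
    · exact hne x hx (sub_eq_zero.1 (he (by rw [h0, map_zero])))
    · exact hpc h0
  -- The angle seen from `c`, rotated so that the direction of the missing point `p` is the branch
  -- cut of `Complex.arg`; it is therefore continuous on `Γ`.
  refine h.not_injOn (f := fun x => Complex.arg (-(e (x - c) / e (p - c)))) ?_ ?_
  · intro x hx
    refine ContinuousAt.continuousWithinAt ?_
    have hslit : -(e (x - c) / e (p - c)) ∈ Complex.slitPlane := by
      rw [Complex.mem_slitPlane_iff]
      by_contra! hle
      rw [Complex.neg_re, Complex.neg_im, neg_nonpos, neg_eq_zero] at hle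
      apply hpΓ
      obtain ⟨r, hr, hr'⟩ : ∃ r : ℝ, 0 ≤ r ∧ (r : ℂ) = e (x - c) / e (p - c) :=
        ⟨_, hle.1, Complex.ext rfl hle.2.symm⟩
      have hr0 : r ≠ 0 := by
        rintro rfl
        exact hnz x (hΓ hx) (by rw [← hr']; simp)
      have hxc : x - c = r • (p - c) := he (by
        rw [map_smul, Complex.real_smul, hr']; field_simp)
      rwa [← hQ.eq_of_sameRay_of_mem_frontier hc hp (hΓ hx) (hr.lt_of_ne' hr0) hxc]
    exact ContinuousAt.comp (g := Complex.arg) (Complex.continuousAt_arg hslit) (by fun_prop)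
  · intro x hx y hy hxy
    rw [Complex.arg_eq_arg_iff (hnz x (hΓ hx)) (hnz y (hΓ hy))] at hxy
    set r : ℝ := ‖-(e (y - c) / e (p - c))‖ / ‖-(e (x - c) / e (p - c))‖ with hr
    have hrpos : 0 < r := div_pos (norm_pos_iff.2 (hnz y (hΓ hy))) (norm_pos_iff.2 (hnz x (hΓ hx)))
    have h1 : (r : ℂ) * -(e (x - c) / e (p - c)) = -(e (y - c) / e (p - c)) := by
      rw [hr]; push_cast; exact hxy
    have hyx : y - c = r • (x - c) := he (by
      rw [map_smul, Complex.real_smul]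
      field_simp at h1
      linear_combination h1)
    exact (hQ.eq_of_sameRay_of_mem_frontier hc (hΓ hx) (hΓ hy) hrpos hyx).symm

/-! ### The six-point obstruction -/

/-- Only two coefficients survive. If `β i ≠ 0`, row `i` forces `β i < β j`, while row `j` forces `β
j ≤ β i`. -/
theorem eq_zero_of_diag_lt {m : Fin 3 → Fin 3 → ℝ} (hd : ∀ i, m i i < -1)
    (ho : ∀ i j, i ≠ j → m i j ≤ 1) {β : Fin 3 → ℝ} (hβ : ∀ i, 0 ≤ β i) {k : Fin 3}
    (hk : β k = 0) (h : ∀ i, 0 ≤ ∑ j, m i j * β j) : ∀ i, β i = 0 := by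
  have key : ∀ i j : Fin 3, i ≠ j → 0 ≤ m i i * β i + m i j * β j →
      0 ≤ m j i * β i + m j j * β j → β i = 0 := by
    intro i j hij hi hj
    have h1 := mul_le_mul_of_nonneg_right (ho i j hij) (hβ j)
    have h2 := mul_le_mul_of_nonneg_right (ho j i hij.symm) (hβ i)
    have h3 := mul_le_mul_of_nonneg_right (hd j).le (hβ j)
    by_contra hne
    have h4 := mul_lt_mul_of_pos_right (hd i) ((hβ i).lt_of_ne' hne)
    linarith
  simp only [Fin.sum_univ_three] at h
  have h0 := h 0
  have h1 := h 1
  have h2 := h 2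
  intro i
  fin_cases k <;> simp only [Fin.zero_eta, Fin.mk_one, Fin.reduceFinMk] at hk <;>
    rw [hk] at h0 h1 h2 <;> fin_cases i <;> first
    | exact hk
    | exact key 0 1 (by decide) (by linarith) (by linarith)
    | exact key 1 0 (by decide) (by linarith) (by linarith)
    | exact key 0 2 (by decide) (by linarith) (by linarith)
    | exact key 2 0 (by decide) (by linarith) (by linarith)
    | exact key 1 2 (by decide) (by linarith) (by linarith)
    | exact key 2 1 (by decide) (by linarith) (by linarith)

/-- The Carathéodory reduction: subtract the multiple of the relation `t` given by the least ratio
`α i / t i`. -/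
theorem exists_nonneg_comb_eq_zero {ι V : Type*} [Fintype ι] [AddCommGroup V] [Module ℝ V]
    {p : ι → V} {t α : ι → ℝ} (ht : ∀ i, 0 ≤ t i) (ht0 : ∃ i, t i ≠ 0)
    (h0 : ∑ i, t i • p i = 0) (hα : ∀ i, 0 ≤ α i) :
    ∃ β : ι → ℝ, (∀ i, 0 ≤ β i) ∧ (∃ k, β k = 0) ∧ ∑ i, β i • p i = ∑ i, α i • p i := by
  classical
  obtain ⟨i₀, hi₀⟩ := ht0
  obtain ⟨k, hk, hmin⟩ := Finset.exists_min_image (Finset.univ.filter fun i => t i ≠ 0)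
    (fun i => α i / t i) ⟨i₀, by simpa using hi₀⟩
  have hk' : t k ≠ 0 := by simpa using hk
  refine ⟨fun i => α i - α k / t k * t i, fun i => ?_, ⟨k, by field_simp; ring⟩, ?_⟩
  · by_cases hi : t i = 0
    · simpa [hi] using hα i
    · have h1 := hmin i (by simpa using hi)
      have h2 := mul_le_mul_of_nonneg_right h1 (ht i)
      rw [div_mul_cancel₀ _ hi] at h2
      linarith
  · simp only [sub_smul, Finset.sum_sub_distrib, mul_smul, ← Finset.smul_sum, h0, smul_zero,
      sub_zero]

theorem mem_convexHull_range_iff {ι : Type*} [Fintype ι] {P : ι → Plane} {x : Plane} :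
    x ∈ convexHull ℝ (Set.range P) ↔
      ∃ w : ι → ℝ, (∀ i, 0 ≤ w i) ∧ ∑ i, w i = 1 ∧ ∑ i, w i • P i = x := by
  constructor
  · intro hx
    have hsub : convexHull ℝ (Set.range P) ⊆
        {x | ∃ w : ι → ℝ, (∀ i, 0 ≤ w i) ∧ ∑ i, w i = 1 ∧ ∑ i, w i • P i = x} := by
      classical
      refine convexHull_min ?_ ?_
      · rintro _ ⟨i, rfl⟩
        refine ⟨Pi.single i 1, fun j => ?_, by simp, by simp [Pi.single_apply, ite_smul]⟩
        rw [Pi.single_apply]; split_ifs <;> norm_num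
      · rintro _ ⟨w, hw, hw1, rfl⟩ _ ⟨w', hw', hw1', rfl⟩ a b ha hb hab
        refine ⟨fun i => a * w i + b * w' i, fun i => ?_, ?_, ?_⟩
        · exact add_nonneg (mul_nonneg ha (hw i)) (mul_nonneg hb (hw' i))
        · rw [Finset.sum_add_distrib, ← Finset.mul_sum, ← Finset.mul_sum, hw1, hw1']; linarith
        · simp only [add_smul, mul_smul, Finset.sum_add_distrib, Finset.smul_sum]
    exact hsub hx
  · rintro ⟨w, hw, hw1, rfl⟩
    exact (convex_convexHull ℝ _).sum_mem (fun i _ => hw i) hw1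
      fun i _ => subset_convexHull ℝ _ ⟨i, rfl⟩

/-- As `P` surrounds `c`, a positive multiple of `-v` is a nonnegative combination of the `P j - c`
with one coefficient zero. Were all `g i v` negative, applying `g i / γ i` would contradict
`eq_zero_of_diag_lt`. -/
theorem not_forall_apply_neg {P : Fin 3 → Plane} {c v : Plane}
    (hc : c ∈ interior (convexHull ℝ (Set.range P))) {g : Fin 3 → Plane →L[ℝ] ℝ} {γ : Fin 3 → ℝ}
    (hγ : ∀ i, 0 < γ i) (hd : ∀ i, g i (P i - c) < -γ i)
    (ho : ∀ i j, i ≠ j → g i (P j - c) ≤ γ i) : ¬ ∀ i, g i v < 0 := by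
  intro hv
  obtain ⟨ε, hεQ, hε⟩ : ∃ ε : ℝ, c - ε • v ∈ convexHull ℝ (Set.range P) ∧ 0 < ε := by
    have hcont : Filter.Tendsto (fun ε : ℝ => c - ε • v) (nhdsWithin 0 (Set.Ioi 0))
        (nhds c) := by
      have : Continuous fun ε : ℝ => c - ε • v := by fun_prop
      simpa using (this.tendsto 0).mono_left nhdsWithin_le_nhds
    exact ((hcont.eventually (mem_interior_iff_mem_nhds.1 hc)).and self_mem_nhdsWithin).exists
  obtain ⟨t, ht, ht1, htc⟩ := mem_convexHull_range_iff.1 (interior_subset hc)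
  obtain ⟨α, hα, hα1, hαc⟩ := mem_convexHull_range_iff.1 hεQ
  have ht0 : ∑ i, t i • (P i - c) = 0 := by
    simp only [smul_sub, Finset.sum_sub_distrib, htc, ← Finset.sum_smul, ht1, one_smul, sub_self]
  have hα0 : ∑ i, α i • (P i - c) = -(ε • v) := by
    simp only [smul_sub, Finset.sum_sub_distrib, hαc, ← Finset.sum_smul, hα1, one_smul]; abel
  obtain ⟨β, hβ, ⟨k, hk⟩, hβv⟩ := exists_nonneg_comb_eq_zero ht
    (by by_contra! h; simp [h] at ht1) ht0 hα
  rw [hα0] at hβv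
  have hpos : ∀ i, 0 < ∑ j, g i (P j - c) / γ i * β j := by
    intro i
    have h1 := congrArg (g i) hβv
    simp only [map_sum, map_smul, map_neg, smul_eq_mul] at h1
    have h2 : ∑ j, g i (P j - c) / γ i * β j = -(ε * g i v) / γ i := by
      rw [← h1, Finset.sum_div]
      exact Finset.sum_congr rfl fun j _ => by ring
    rw [h2]
    exact div_pos (by nlinarith [hv i]) (hγ i)
  have hz := eq_zero_of_diag_lt (m := fun i j => g i (P j - c) / γ i)
    (fun i => by rw [div_lt_iff₀ (hγ i)]; linarith [hd i])
    (fun i j hij => by rw [div_le_one (hγ i)]; exact ho i j hij) hβ hk fun i => (hpos i).le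
  have := hpos 0
  simp [hz] at this

/-- Hahn–Banach; a hull without interior is treated apart, using a nonzero functional constant on
`S`. -/
theorem mem_interior_convexHull_of_forall {S : Set Plane} (hS : S.Nonempty) {c : Plane}
    (h : ∀ u : Plane →L[ℝ] ℝ, (∀ x ∈ S, u c ≤ u x) → u = 0) : c ∈ interior (convexHull ℝ S) := by
  by_contra hc
  rcases (interior (convexHull ℝ S)).eq_empty_or_nonempty with he | hne
  · obtain ⟨f, hf, hconst⟩ := exists_apply_eq_of_interior_convexHull_eq_empty hS he
    obtain ⟨y, hy⟩ := hS
    rcases le_total (f c) (f y) with hle | hle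
    · exact hf (h f fun x hx => hle.trans_eq (hconst y hy x hx))
    · refine hf (neg_eq_zero.1 (h (-f) fun x hx => ?_))
      simpa using (hconst x hx y hy).trans_le hle
  · have hconv := convex_convexHull ℝ S
    obtain ⟨g, hg⟩ := geometric_hahn_banach_open_point hconv.interior isOpen_interior hc
    have hg0 : -g = 0 := by
      refine h (-g) fun x hx => ?_
      have hx' : x ∈ closure (interior (convexHull ℝ S)) := by
        rw [hconv.closure_interior_eq_closure_of_nonempty_interior hne]
        exact subset_closure (subset_convexHull ℝ S hx)
      have : g x ≤ g c := closure_minimal (t := {x | g x ≤ g c}) (fun y hy => (hg y hy).le)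
        (isClosed_le g.continuous continuous_const) hx'
      simpa using this
    obtain ⟨x, hx⟩ := hne
    rw [neg_eq_zero] at hg0
    simpa [hg0] using hg x hx

/-- The determinant of two functionals in the standard coordinates. -/
noncomputable def dualDet (f g : Plane →L[ℝ] ℝ) : ℝ :=
  f (EuclideanSpace.single 0 1) * g (EuclideanSpace.single 1 1) -
    f (EuclideanSpace.single 1 1) * g (EuclideanSpace.single 0 1)

theorem exists_eq_smul_of_dualDet_eq_zero {f g : Plane →L[ℝ] ℝ} (hf : f ≠ 0)
    (h : dualDet f g = 0) : ∃ r : ℝ, g = r • f := by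
  unfold dualDet at h
  set a := f (EuclideanSpace.single 0 1) with ha
  set b := f (EuclideanSpace.single 1 1) with hb
  have hab : a ≠ 0 ∨ b ≠ 0 := by
    by_contra! h
    apply hf
    ext x
    rw [Plane.apply_eq, ← ha, ← hb, h.1, h.2]; simp
  rcases hab with h' | h'
  · refine ⟨g (EuclideanSpace.single 0 1) / a, ?_⟩
    ext x
    rw [Plane.apply_eq, _root_.smul_apply, Plane.apply_eq f, ← ha, ← hb, smul_eq_mul]
    field_simp
    linear_combination x 1 * h
  · refine ⟨g (EuclideanSpace.single 1 1) / b, ?_⟩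
    ext x
    rw [Plane.apply_eq, _root_.smul_apply, Plane.apply_eq f, ← ha, ← hb, smul_eq_mul]
    field_simp
    linear_combination -x 0 * h

theorem exists_apply_eq_of_dualDet_ne_zero {f g : Plane →L[ℝ] ℝ} (h : dualDet f g ≠ 0)
    (r s : ℝ) : ∃ c : Plane, f c = r ∧ g c = s := by
  refine ⟨!₂[(r * g (EuclideanSpace.single 1 1) - s * f (EuclideanSpace.single 1 1)) / dualDet f g,
    (s * f (EuclideanSpace.single 0 1) - r * g (EuclideanSpace.single 0 1)) / dualDet f g], ?_, ?_⟩
  all_goals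
    rw [Plane.apply_eq]
    simp only [Matrix.cons_val_zero, Matrix.cons_val_one, Matrix.cons_val_fin_one]
    field_simp
    unfold dualDet
    ring

theorem exists_eq_comb_of_dualDet_ne_zero {f g : Plane →L[ℝ] ℝ} (h : dualDet f g ≠ 0)
    (u : Plane →L[ℝ] ℝ) : ∃ r s : ℝ, u = r • f + s • g := by
  refine ⟨dualDet u g / dualDet f g, dualDet f u / dualDet f g, ?_⟩
  ext x
  simp only [_root_.add_apply, _root_.smul_apply, smul_eq_mul]
  rw [Plane.apply_eq u, Plane.apply_eq f x, Plane.apply_eq g x]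
  field_simp
  unfold dualDet
  ring

/-- Dual use of `eq_zero_of_diag_lt`: a functional `u` that is nonnegative on all `P i - c` is a
nonnegative combination of the `f j` with one coefficient zero, hence zero. -/
theorem mem_interior_convexHull_range {f : Fin 3 → Plane →L[ℝ] ℝ} (hf : ∑ i, f i = 0)
    (hdet : dualDet (f 0) (f 1) ≠ 0) {a : Fin 3 → ℝ} (ha : ∀ i, 0 < a i) {P : Fin 3 → Plane}
    {c : Plane} (hd : ∀ i, f i (P i - c) < -a i) (ho : ∀ i j, i ≠ j → f i (P j - c) ≤ a i) :
    c ∈ interior (convexHull ℝ (Set.range P)) := by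
  refine mem_interior_convexHull_of_forall (Set.range_nonempty P) fun u hu => ?_
  obtain ⟨r, s, hrs⟩ := exists_eq_comb_of_dualDet_ne_zero hdet u
  -- Adding `|r| + |s|` times the relation `f 0 + f 1 + f 2 = 0` makes the coefficients of `u`
  -- nonnegative.
  obtain ⟨β, hβ, ⟨k, hk⟩, hβu⟩ := exists_nonneg_comb_eq_zero (p := f) (t := fun _ => 1)
    (α := ![r + (|r| + |s|), s + (|r| + |s|), |r| + |s|]) (fun _ => zero_le_one)
    ⟨0, one_ne_zero⟩ (by simpa using hf) (by
      intro i
      have h1 := neg_abs_le r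
      have h2 := neg_abs_le s
      have h3 := abs_nonneg r
      have h4 := abs_nonneg s
      fin_cases i
      · simp; linarith
      · simp; linarith
      · simp; linarith)
  have hu' : ∑ i, β i • f i = u := by
    rw [hβu, hrs]
    simp only [Fin.sum_univ_three] at hf ⊢
    simp only [Matrix.cons_val_zero, Matrix.cons_val_one, Matrix.cons_val]
    have : (|r| + |s|) • (f 0 + f 1 + f 2) = 0 := by rw [hf, smul_zero]
    rw [← sub_eq_zero, ← this]
    module
  have hz := eq_zero_of_diag_lt (m := fun i j => f j (P i - c) / a j)
    (β := fun j => a j * β j) (k := k)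
    (fun i => by rw [div_lt_iff₀ (ha i)]; linarith [hd i])
    (fun i j hij => by rw [div_le_one (ha j)]; exact ho j i hij.symm)
    (fun i => mul_nonneg (ha i).le (hβ i)) (by simp [hk]) (by
      intro i
      have h1 : ∑ j, f j (P i - c) / a j * (a j * β j) = u (P i - c) := by
        rw [← hu']
        simp only [_root_.sum_apply, _root_.smul_apply, smul_eq_mul]
        refine Finset.sum_congr rfl fun j _ => ?_
        have := (ha j).ne'
        field_simp
      rw [h1, map_sub, sub_nonneg]
      exact hu _ ⟨i, rfl⟩)
  have hβ0 : ∀ i, β i = 0 := fun i => by simpa [(ha i).ne'] using hz i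
  rw [← hu']
  simp [hβ0]

theorem exists_mem_frontier_segment {Q : Set Plane} (hQ : IsClosed Q) {c d : Plane}
    (hc : c ∈ interior Q) (hd : c + d ∉ Q) :
    ∃ r : ℝ, 0 < r ∧ r < 1 ∧ c + r • d ∈ frontier Q := by
  have hcont : Continuous fun r : ℝ => c + r • d := by fun_prop
  have hpre : IsPreconnected ((fun r : ℝ => c + r • d) '' Set.Icc 0 1) :=
    isPreconnected_Icc.image _ hcont.continuousOn
  obtain ⟨r, hr, hx⟩ : ∃ r ∈ Set.Icc (0 : ℝ) 1, c + r • d ∈ frontier Q := by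
    by_contra! hno
    obtain ⟨x, -, hx, hx'⟩ := hpre (interior Q) Qᶜ isOpen_interior hQ.isOpen_compl
      (by
        rintro _ ⟨r, hr, rfl⟩
        by_contra hx
        rw [Set.mem_union, not_or, Set.mem_compl_iff, not_not] at hx
        exact hno r hr ⟨subset_closure hx.2, hx.1⟩)
      ⟨c, ⟨0, by simp, by simp⟩, hc⟩ ⟨c + d, ⟨1, by simp, by simp⟩, hd⟩
    exact hx' (interior_subset hx)
  refine ⟨r, hr.1.lt_of_ne' ?_, hr.2.lt_of_ne ?_, hx⟩
  · rintro rfl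
    exact hx.2 (by simpa using hc)
  · rintro rfl
    exact hd (by simpa using hQ.frontier_subset hx)

/-- Six points on chords through `c`, the chord pieces being longer at the `P i`, which surround
`c`, are not in centrally symmetric convex position. -/
theorem not_inCSCPosition_of_chords {P : Fin 3 → Plane} {c : Plane}
    (hc : c ∈ interior (convexHull ℝ (Set.range P))) {r : Fin 3 → ℝ} (hr : ∀ i, 0 < r i)
    (hr1 : ∀ i, r i < 1) :
    ¬ InCSCPosition (Set.range P ∪ Set.range fun i => c + r i • (c - P i)) := by
  rintro ⟨K, ⟨hKc, hKconv, hKi, o, ho⟩, hsub⟩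
  have hPK : ∀ i, P i ∈ K := fun i => hKc.isClosed.frontier_subset (hsub (Or.inl ⟨i, rfl⟩))
  have hcK : c ∈ interior K :=
    interior_mono (convexHull_min (by rintro _ ⟨i, rfl⟩; exact hPK i) hKconv) hc
  choose g _ hg hgi using fun i =>
    exists_support_of_mem_frontier hKconv hKi (hsub (Or.inr ⟨i, rfl⟩))
  simp only [map_add, map_smul, map_sub, smul_eq_mul] at hg hgi
  have hγ : ∀ i, 0 < r i * (g i c - g i (P i)) := fun i => by linarith [hgi i c hcK]
  have hlt : ∀ i, g i (P i - c) < -(r i * (g i c - g i (P i))) := fun i => by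
    have h1 : 0 < g i c - g i (P i) := (mul_pos_iff_of_pos_left (hr i)).1 (hγ i)
    have h2 := mul_lt_mul_of_pos_right (hr1 i) h1
    rw [map_sub]; linarith
  -- The reflection `2 o - P i` stays below the supporting line at the short end, while `2 c - P i`
  -- is beyond it since `r i < 1`; hence `g i (o - c) < 0` for every `i`.
  refine not_forall_apply_neg hc (v := o - c) hγ hlt (fun i j _ => ?_) fun i => ?_
  · rw [map_sub]; linarith [hg i _ (hPK j)]
  · have h1 := hg i _ (ho _ (hPK i))
    have h2 := hlt i
    rw [map_sub] at h2 ⊢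
    rw [map_sub, map_smul, smul_eq_mul] at h1
    linarith

theorem EveryInCSCPosition.inCSCPosition_union_range {Γ : Set Plane} (hinf : Γ.Infinite)
    (h6 : EveryInCSCPosition 6 Γ) {P R : Fin 3 → Plane} (hP : ∀ i, P i ∈ Γ) (hR : ∀ i, R i ∈ Γ) :
    InCSCPosition (Set.range P ∪ Set.range R) := by
  classical
  have h := h6.of_card_le hinf (Finset.univ.image P ∪ Finset.univ.image R) (by
      intro x hx
      simp only [Finset.coe_union, Finset.coe_image, Finset.coe_univ, Set.image_univ] at hx
      rcases hx with ⟨i, rfl⟩ | ⟨i, rfl⟩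
      exacts [hP i, hR i])
    ((Finset.card_union_le _ _).trans (by
      have h1 : (Finset.univ.image P).card ≤ 3 := Finset.card_image_le
      have h2 : (Finset.univ.image R).card ≤ 3 := Finset.card_image_le
      omega))
  simpa using h

/-! ### Central symmetry through the support function -/

section SupportFunction

variable {Q : Set Plane} {M : (Plane →L[ℝ] ℝ) → ℝ}

theorem exists_isGreatest_apply (hQ : IsCompact Q) (hne : Q.Nonempty) :
    ∃ M : (Plane →L[ℝ] ℝ) → ℝ, ∀ f : Plane →L[ℝ] ℝ, IsGreatest (f '' Q) (M f) := by
  choose M hM using fun f : Plane →L[ℝ] ℝ =>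
    (hQ.image f.continuous).exists_isGreatest (hne.image f)
  exact ⟨M, hM⟩

theorem supportDiff_smul (hM : ∀ f : Plane →L[ℝ] ℝ, IsGreatest (f '' Q) (M f)) (r : ℝ)
    (f : Plane →L[ℝ] ℝ) : M (r • f) - M (-(r • f)) = r * (M f - M (-f)) := by
  have key : ∀ {r : ℝ} (f : Plane →L[ℝ] ℝ), 0 ≤ r → M (r • f) = r * M f := by
    intro r f hr
    refine (hM (r • f)).unique ⟨?_, ?_⟩
    · obtain ⟨x, hx, hxf⟩ := (hM f).1
      exact ⟨x, hx, by simp [hxf]⟩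
    · rintro _ ⟨x, hx, rfl⟩
      exact mul_le_mul_of_nonneg_left ((hM f).2 ⟨x, hx, rfl⟩) hr
  rcases le_total 0 r with hr | hr
  · have h1 : -(r • f) = r • (-f) := by module
    rw [h1, key f hr, key (-f) hr]; ring
  · have h1 : r • f = (-r) • (-f) := by module
    have h2 : -(r • f) = (-r) • f := by module
    rw [h2, h1, key f (by linarith), key (-f) (by linarith)]; ring

/-- The triple `f, g, -(f + g)` makes the odd function `G` subadditive, hence additive and so
linear: `G f = f (2 o)`. Thus `Q` and its reflection in `o` have the same support function. -/
theorem exists_center_of_forall_sum_nonneg (hQ : IsCompact Q) (hconv : Convex ℝ Q)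
    (hM : ∀ f : Plane →L[ℝ] ℝ, IsGreatest (f '' Q) (M f))
    (h : ∀ f : Fin 3 → Plane →L[ℝ] ℝ, ∑ i, f i = 0 → 0 ≤ ∑ i, (M (f i) - M (-f i))) :
    ∃ o : Plane, ∀ x ∈ Q, (2 : ℝ) • o - x ∈ Q := by
  set G : (Plane →L[ℝ] ℝ) → ℝ := fun f => M f - M (-f) with hG
  have hGneg : ∀ f, G (-f) = -G f := fun f => by simp [hG]
  have hGsmul : ∀ (r : ℝ) f, G (r • f) = r * G f := supportDiff_smul hM
  have hle : ∀ f g, G (f + g) ≤ G f + G g := fun f g => by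
    have h1 := h ![f, g, -(f + g)] (by simp [Fin.sum_univ_three])
    simp only [Fin.sum_univ_three, Matrix.cons_val_zero, Matrix.cons_val_one,
      Matrix.cons_val] at h1
    have h2 := hGneg (f + g)
    simp only [hG] at h2 ⊢
    linarith
  have hGadd : ∀ f g, G (f + g) = G f + G g := fun f g => by
    refine (hle f g).antisymm ?_
    have h1 := hle (-f) (-g)
    rw [← neg_add, hGneg, hGneg, hGneg] at h1
    linarith
  set o : Plane := !₂[G (EuclideanSpace.proj 0) / 2, G (EuclideanSpace.proj 1) / 2] with ho
  have hGo : ∀ f, G f = f ((2 : ℝ) • o) := fun f => by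
    have hf : f = f (EuclideanSpace.single 0 1) • (EuclideanSpace.proj 0 : Plane →L[ℝ] ℝ) +
        f (EuclideanSpace.single 1 1) • (EuclideanSpace.proj 1 : Plane →L[ℝ] ℝ) := by
      ext x
      rw [Plane.apply_eq]
      simp [mul_comm]
    conv_lhs => rw [hf]
    rw [hGadd, hGsmul, hGsmul, Plane.apply_eq f ((2 : ℝ) • o)]
    simp [ho]
    ring
  refine ⟨o, fun x hx => ?_⟩
  by_contra hxo
  obtain ⟨f, u, hfu, hu⟩ := geometric_hahn_banach_closed_point hconv hQ.isClosed hxo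
  obtain ⟨y, hy, hyM⟩ := (hM f).1
  have h1 := hfu y hy
  have h2 : (-f) x ≤ M (-f) := (hM (-f)).2 ⟨x, hx, rfl⟩
  have h3 := hGo f
  simp only [hG, map_sub, _root_.neg_apply] at h2 h3 hu
  linarith

theorem not_everyInCSCPosition_six_of_sum_neg (hQ : IsCompact Q) (hi : (interior Q).Nonempty)
    (hinf : (frontier Q).Infinite) (hconv : Convex ℝ Q)
    (hM : ∀ f : Plane →L[ℝ] ℝ, IsGreatest (f '' Q) (M f)) {f : Fin 3 → Plane →L[ℝ] ℝ}
    (hf : ∑ i, f i = 0) (hneg : ∑ i, (M (f i) - M (-f i)) < 0) :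
    ¬ EveryInCSCPosition 6 (frontier Q) := by
  intro h6
  have hf2 : f 2 = -(f 0 + f 1) := by
    rw [Fin.sum_univ_three] at hf
    rw [eq_neg_iff_add_eq_zero, add_comm]; exact hf
  -- On proportional functionals homogeneity would make the sum zero.
  have hdet : dualDet (f 0) (f 1) ≠ 0 := by
    intro hdet
    rw [Fin.sum_univ_three] at hneg
    by_cases hf0 : f 0 = 0
    · rw [hf2, hf0] at hneg
      simp at hneg
    · obtain ⟨κ, hκ⟩ := exists_eq_smul_of_dualDet_eq_zero hf0 hdet
      have h2 : f 2 = (-(1 + κ)) • f 0 := by rw [hf2, hκ]; module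
      rw [hκ, h2, supportDiff_smul hM, supportDiff_smul hM] at hneg
      linarith
  have hf0 : ∀ i, f i ≠ 0 := by
    intro i h
    apply hdet
    have h2 := hf2
    fin_cases i
    · have h : f 0 = 0 := h
      simp [dualDet, h]
    · have h : f 1 = 0 := h
      simp [dualDet, h]
    · have h : f 2 = 0 := h
      have h' : f 1 = -f 0 := by
        rw [h] at h2
        rw [eq_neg_iff_add_eq_zero, add_comm]; exact neg_eq_zero.1 h2.symm
      simp [dualDet, h']; ring
  -- `P i` minimises `f i` on `Q`.
  choose P hPQ hP using fun i => (hM (-f i)).1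
  replace hP : ∀ i, f i (P i) = -M (-f i) := fun i => by
    rw [← hP i]; simp
  have hle : ∀ i, ∀ x ∈ Q, f i x ≤ M (f i) := fun i x hx => (hM (f i)).2 ⟨x, hx, rfl⟩
  have hge : ∀ i, ∀ x ∈ Q, f i (P i) ≤ f i x := fun i x hx => by
    have := (hM (-f i)).2 ⟨x, hx, rfl⟩
    rw [_root_.neg_apply] at this
    linarith [hP i]
  have hPfr : ∀ i, P i ∈ frontier Q := fun i =>
    mem_frontier_of_support (hPQ i) (neg_ne_zero.2 (hf0 i)) fun x hx => by
      simpa using hge i x hx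
  obtain ⟨q, hq⟩ := hi
  set T := ∑ i, M (f i) with hT
  set w : Fin 3 → ℝ := fun i => M (f i) - f i (P i) with hw
  have hlt : ∀ i, f i q < M (f i) := fun i => by
    obtain ⟨x, hx, hlt⟩ := exists_lt_apply_of_mem_interior hq (hf0 i)
    exact hlt.trans_le (hle i x hx)
  have hwpos : ∀ i, 0 < w i := fun i => by
    have := hge i q (interior_subset hq)
    simp only [hw]; linarith [hlt i]
  have hfx : ∀ x, f 0 x + f 1 x + f 2 x = 0 := fun x => by
    rw [hf2]; simp
  have hTpos : 0 < T := by
    rw [hT, Fin.sum_univ_three]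
    linarith [hfx q, hlt 0, hlt 1, hlt 2]
  set W := ∑ i, w i with hW
  have hWT : 2 * T < W := by
    simp only [Fin.sum_univ_three, hT, hW, hw, hP] at hneg ⊢
    linarith
  have hWpos : 0 < W := by linarith
  -- Depths of `c` below the upper lines. They must add up to `T` to be compatible with `∑ f i = 0`;
  -- taking them proportional to the widths turns `2 * T < W` into `2 * a i < w i` for all `i`.
  set a : Fin 3 → ℝ := fun i => T * w i / W with ha
  have hapos : ∀ i, 0 < a i := fun i => div_pos (mul_pos hTpos (hwpos i)) hWpos
  have haw : ∀ i, 2 * a i < w i := fun i => by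
    have h1 := mul_lt_mul_of_pos_right hWT (hwpos i)
    simp only [ha]
    rw [← mul_div_assoc, div_lt_iff₀ hWpos]; linarith
  have hasum : a 0 + a 1 + a 2 = T := by
    have : w 0 + w 1 + w 2 = W := by rw [hW, Fin.sum_univ_three]
    simp only [ha]
    field_simp
    linear_combination this
  obtain ⟨c, hc0, hc1⟩ := exists_apply_eq_of_dualDet_ne_zero hdet (M (f 0) - a 0) (M (f 1) - a 1)
  have hc : ∀ i, f i c = M (f i) - a i := by
    intro i
    fin_cases i
    · exact hc0
    · exact hc1
    · have h1 := hfx c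
      have h2 : T = M (f 0) + M (f 1) + M (f 2) := by rw [hT, Fin.sum_univ_three]
      simp only [Fin.reduceFinMk]
      linarith
  have hcP : c ∈ interior (convexHull ℝ (Set.range P)) := by
    refine mem_interior_convexHull_range hf hdet hapos (fun i => ?_) fun i j _ => ?_
    · have h1 := haw i
      simp only [hw] at h1
      rw [map_sub, hc]; linarith
    · rw [map_sub, hc]; linarith [hle i _ (hPQ j)]
  have hcQ : c ∈ interior Q :=
    interior_mono (convexHull_min (by rintro _ ⟨i, rfl⟩; exact hPQ i) hconv) hcP
  -- At the reflection of `P i` in `c`, `f i` exceeds its maximum by `w i - 2 * a i`.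
  have hout : ∀ i, c + (c - P i) ∉ Q := fun i hmem => by
    have h1 := hle i _ hmem
    have h2 := haw i
    simp only [hw] at h2
    rw [map_add, map_sub, hc] at h1
    linarith
  choose r hr hr1 hrQ using fun i => exists_mem_frontier_segment hQ.isClosed hcQ (hout i)
  exact not_inCSCPosition_of_chords hcP hr hr1 (h6.inCSCPosition_union_range hinf hPfr hrQ)

end SupportFunction

theorem IsClosedCurve.boundsCSCRegion {Γ : Set Plane} (h : IsClosedCurve Γ)
    (h6 : EveryInCSCPosition 6 Γ) : BoundsCSCRegion Γ := by
  have hconv := (convex_convexHull ℝ Γ).closure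
  have hcomp : IsCompact (closure (convexHull ℝ Γ)) := Metric.isCompact_of_isClosed_isBounded
    isClosed_closure (isBounded_convexHull.2 h.isCompact.isBounded).closure
  have hint := (convex_convexHull ℝ Γ).interior_closure_eq_interior_of_nonempty_interior
    h.interior_convexHull_nonempty
  have hi : (interior (closure (convexHull ℝ Γ))).Nonempty :=
    hint.symm ▸ h.interior_convexHull_nonempty
  have hΓ := h.eq_frontier hconv hi (by
    rw [frontier, closure_closure, hint]
    exact subset_frontier_convexHull h.infinite h6)
  obtain ⟨M, hM⟩ := exists_isGreatest_apply hcomp (hi.mono interior_subset)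
  refine ⟨_, ⟨hcomp, hconv, hi, ?_⟩, hΓ.symm⟩
  refine exists_center_of_forall_sum_nonneg hcomp hconv hM fun f hf => ?_
  by_contra! hneg
  exact not_everyInCSCPosition_six_of_sum_neg hcomp hi (hΓ ▸ h.infinite) hconv hM hf hneg (hΓ ▸ h6)

/-! ### Conics through five points -/

/-- The functional `(x, y) ↦ a * x + b * y`. -/
noncomputable def Plane.lin (a b : ℝ) : Plane →L[ℝ] ℝ :=
  a • (EuclideanSpace.proj 0 : Plane →L[ℝ] ℝ) + b • (EuclideanSpace.proj 1 : Plane →L[ℝ] ℝ)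

@[simp]
theorem Plane.lin_apply (a b : ℝ) (x : Plane) : Plane.lin a b x = a * x 0 + b * x 1 := rfl

@[simp]
theorem dualDet_lin (a b c d : ℝ) : dualDet (Plane.lin a b) (Plane.lin c d) = a * d - b * c := by
  simp [dualDet]

theorem Plane.lin_ne_zero {a b : ℝ} (h : a ≠ 0 ∨ b ≠ 0) : Plane.lin a b ≠ 0 := by
  intro h0
  have h1 := DFunLike.congr_fun h0 (EuclideanSpace.single 0 1)
  have h2 := DFunLike.congr_fun h0 (EuclideanSpace.single 1 1)
  simp at h1 h2
  tauto

/-- Five linear conditions on six coefficients. -/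
theorem exists_conic {Y : Finset Plane} (hY : Y.card = 5) :
    ∃ a b c d e k : ℝ, ¬ (a = 0 ∧ b = 0 ∧ c = 0 ∧ d = 0 ∧ e = 0 ∧ k = 0) ∧
      ∀ p ∈ Y, a * p 0 ^ 2 + b * (p 0 * p 1) + c * p 1 ^ 2 + d * p 0 + e * p 1 + k = 0 := by
  let A : Matrix Y (Fin 6) ℝ :=
    fun p => ![p.1 0 ^ 2, p.1 0 * p.1 1, p.1 1 ^ 2, p.1 0, p.1 1, 1]
  have hker : LinearMap.ker A.mulVecLin ≠ ⊥ :=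
    LinearMap.ker_ne_bot_of_finrank_lt (by simp [hY])
  obtain ⟨w, hw, hw0⟩ := Submodule.exists_mem_ne_zero_of_ne_bot hker
  refine ⟨w 0, w 1, w 2, w 3, w 4, w 5, ?_, fun p hp => ?_⟩
  · rintro ⟨h0, h1, h2, h3, h4, h5⟩
    apply hw0
    ext i
    fin_cases i <;> assumption
  · have h := congrFun (LinearMap.mem_ker.1 hw) ⟨p, hp⟩
    rw [Matrix.mulVecLin_apply, Matrix.mulVec, dotProduct, Fin.sum_univ_six] at h
    simp only [A, Matrix.cons_val, Pi.zero_apply] at h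
    linarith

theorem exists_two_roots (κ m : ℝ) :
    ∃ s₁ s₂ : ℝ, ∀ t : ℝ, t ^ 2 + κ * t + m = 0 → t = s₁ ∨ t = s₂ := by
  by_cases h : ∃ s, s ^ 2 + κ * s + m = 0
  · obtain ⟨s, hs⟩ := h
    refine ⟨s, -κ - s, fun t ht => ?_⟩
    have : (t - s) * (t - (-κ - s)) = 0 := by linear_combination ht - hs
    rcases mul_eq_zero.1 this with h | h
    · exact Or.inl (by linarith)
    · exact Or.inr (by linarith)
  · exact ⟨0, 0, fun t ht => absurd ⟨t, ht⟩ h⟩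

/-- Affine normal forms of a nontrivial quadratic equation in the plane. -/
theorem conic_normal_form {Y : Set Plane} {a b c d e k : ℝ}
    (h0 : ¬ (a = 0 ∧ b = 0 ∧ c = 0 ∧ d = 0 ∧ e = 0 ∧ k = 0))
    (hq : ∀ p ∈ Y, a * p 0 ^ 2 + b * (p 0 * p 1) + c * p 1 ^ 2 + d * p 0 + e * p 1 + k = 0)
    (hY : Y.Nonempty) :
    (∃ (f : Plane →L[ℝ] ℝ) (s₁ s₂ : ℝ), f ≠ 0 ∧ ∀ p ∈ Y, f p = s₁ ∨ f p = s₂) ∨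
    ∃ (f g : Plane →L[ℝ] ℝ) (s t C : ℝ), dualDet f g ≠ 0 ∧
      ((∀ p ∈ Y, (f p + s) ^ 2 + (g p + t) ^ 2 = C) ∨ (∀ p ∈ Y, (f p + s) * (g p + t) = C) ∨
        ∀ p ∈ Y, g p + t = f p ^ 2) := by
  rcases lt_trichotomy (b ^ 2) (4 * a * c) with hΔ | hΔ | hΔ
  · have ha : a ≠ 0 := by rintro rfl; nlinarith [sq_nonneg b]
    have hD : 0 < 4 * a * c - b ^ 2 := by linarith
    set r := √(4 * a * c - b ^ 2) with hr
    have hr2 : r ^ 2 = 4 * a * c - b ^ 2 := Real.sq_sqrt hD.le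
    have hr0 : r ≠ 0 := (Real.sqrt_pos.2 hD).ne'
    -- Multiply by `4 * a` and complete both squares.
    refine Or.inr ⟨Plane.lin (2 * a) b, Plane.lin 0 r, d, (2 * a * e - b * d) / r,
      ((2 * a * e - b * d) / r) ^ 2 + d ^ 2 - 4 * a * k, by simp [ha, hr0],
      Or.inl fun p hp => ?_⟩
    have h1 : r * ((2 * a * e - b * d) / r) = 2 * a * e - b * d := by field_simp
    simp only [Plane.lin_apply]
    linear_combination 4 * a * hq p hp + p 1 ^ 2 * hr2 + 2 * p 1 * h1
  · by_cases ha : a = 0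
    · subst ha
      have hb : b = 0 := by simpa using hΔ
      subst hb
      by_cases hc : c = 0
      · subst hc
        by_cases hde : d = 0 ∧ e = 0
        · obtain ⟨p, hp⟩ := hY
          have := hq p hp
          simp [hde.1, hde.2] at this h0
          exact absurd this h0
        · refine Or.inl ⟨Plane.lin d e, -k, -k, Plane.lin_ne_zero (by tauto), fun p hp => ?_⟩
          left
          have := hq p hp
          simp only [Plane.lin_apply]; linarith
      · by_cases hd : d = 0
        · subst hd
          obtain ⟨s₁, s₂, hs⟩ := exists_two_roots (e / c) (k / c)
          refine Or.inl ⟨Plane.lin 0 1, s₁, s₂, Plane.lin_ne_zero (by simp), fun p hp => ?_⟩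
          have h1 := hs (p 1) (by field_simp; linarith [hq p hp])
          simpa using h1
        · refine Or.inr ⟨Plane.lin 0 1, Plane.lin (-d / c) (-e / c), 0, -k / c, 0, ?_,
            Or.inr (Or.inr fun p hp => ?_)⟩
          · simp [hc, hd]
          · have h1 := hq p hp
            simp only [Plane.lin_apply]
            field_simp
            linarith
    · by_cases hdet : a * (2 * a * e - b * d) = 0
      · have h1 : 2 * a * e = b * d := by
          rcases mul_eq_zero.1 hdet with h | h
          · exact absurd h ha
          · linarith
        obtain ⟨s₁, s₂, hs⟩ := exists_two_roots (2 * d) (4 * a * k)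
        refine Or.inl ⟨Plane.lin (2 * a) b, s₁, s₂, Plane.lin_ne_zero (by simp [ha]),
          fun p hp => hs _ ?_⟩
        simp only [Plane.lin_apply]
        linear_combination 4 * a * hq p hp + p 1 ^ 2 * hΔ - 2 * p 1 * h1
      · refine Or.inr ⟨Plane.lin (2 * a) b, Plane.lin (-(4 * a * d)) (-(4 * a * e)), 0,
          -(4 * a * k), 0, ?_, Or.inr (Or.inr fun p hp => ?_)⟩
        · rw [dualDet_lin]
          intro h
          exact hdet (by linarith)
        · simp only [Plane.lin_apply]
          linear_combination -4 * a * hq p hp - p 1 ^ 2 * hΔ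
  · right
    obtain ⟨α, β, γ, δ, hdet, h1, h2, h3⟩ : ∃ α β γ δ : ℝ, α * δ - β * γ ≠ 0 ∧ α * γ = a ∧
        α * δ + β * γ = b ∧ β * δ = c := by
      by_cases ha : a = 0
      · subst ha
        have hb : b ≠ 0 := by rintro rfl; simp at hΔ
        exact ⟨0, 1, b, c, by simpa using hb, by ring, by ring, by ring⟩
      · have hD : 0 < b ^ 2 - 4 * a * c := by linarith
        set r := √(b ^ 2 - 4 * a * c) with hr
        have hr2 : r ^ 2 = b ^ 2 - 4 * a * c := Real.sq_sqrt hD.le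
        have hr0 : r ≠ 0 := (Real.sqrt_pos.2 hD).ne'
        refine ⟨a, (b - r) / 2, 1, (b + r) / (2 * a), ?_, by ring, ?_, ?_⟩
        · have : a * ((b + r) / (2 * a)) - (b - r) / 2 * 1 = r := by field_simp; ring
          rwa [this]
        · field_simp; ring
        · field_simp; linear_combination -hr2
    -- The quadratic part is a product of independent factors; writing the linear part in them
    -- completes the product.
    obtain ⟨s, t, hst⟩ := exists_eq_comb_of_dualDet_ne_zero (f := Plane.lin α β)
      (g := Plane.lin γ δ) (by simpa using hdet) (Plane.lin d e)
    refine ⟨Plane.lin α β, Plane.lin γ δ, t, s, s * t - k, by simpa using hdet,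
      Or.inr (Or.inl fun p hp => ?_)⟩
    have h4 := DFunLike.congr_fun hst p
    simp only [Plane.lin_apply, _root_.add_apply, _root_.smul_apply, smul_eq_mul] at h4 ⊢
    linear_combination hq p hp + p 0 ^ 2 * h1 + p 0 * p 1 * h2 + p 1 ^ 2 * h3 - h4

/-! ### Convex independence, lines and coordinates -/

/-- Among three collinear points one lies between the other two; the cases on `t` decide which. -/
theorem card_filter_apply_eq_le {Y : Finset Plane}
    (hY : ConvexIndependent ℝ (Subtype.val : ↥(Y : Set Plane) → Plane)) {f : Plane →L[ℝ] ℝ}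
    (hf : f ≠ 0) (s : ℝ) : (Y.filter fun p => f p = s).card ≤ 2 := by
  rw [convexIndependent_set_iff_notMem_convexHull_sdiff] at hY
  by_contra! hlt
  obtain ⟨x, hx, y, hy, z, hz, hxy, hxz, hyz⟩ := Finset.two_lt_card.1 hlt
  rw [Finset.mem_filter] at hx hy hz
  have key : ∀ {p q r : Plane} {t : ℝ}, p ∈ Y → q ∈ Y → r ∈ Y → p ≠ r → q ≠ r → 0 ≤ t → t ≤ 1 →
      r = (1 - t) • p + t • q → False := by
    intro p q r t hp hq hr hpr hqr ht ht1 h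
    refine hY r hr ?_
    have hconv := convex_convexHull ℝ ((Y : Set Plane) \ {r})
    rw [h]
    have hp' := subset_convexHull ℝ _ (show p ∈ (Y : Set Plane) \ {r} from ⟨hp, hpr⟩)
    have hq' := subset_convexHull ℝ _ (show q ∈ (Y : Set Plane) \ {r} from ⟨hq, hqr⟩)
    rw [h] at hp' hq' hconv
    exact hconv hp' hq' (by linarith) ht (by ring)
  obtain ⟨t, ht⟩ := Plane.exists_eq_smul (z := z - x) hf (sub_ne_zero.2 hxy.symm)
    (by rw [map_sub, hx.2, hy.2, sub_self]) (by rw [map_sub, hx.2, hz.2, sub_self])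
  have hzt : z = (1 - t) • x + t • y := by
    rw [← sub_add_cancel z x, ht]; module
  rcases le_or_gt t 0 with h0 | h0
  · refine key (t := 1 / (1 - t)) hy.1 hz.1 hx.1 hxy.symm hxz.symm
      (one_div_nonneg.2 (by linarith)) ?_ ?_
    · exact (div_le_one (by linarith)).2 (by linarith)
    · have h1 : 1 / (1 - t) * (1 - t) = 1 := one_div_mul_cancel (by linarith)
      have h2 := congrArg (fun r : ℝ => r • (y - x)) h1
      rw [← sub_eq_zero] at h2 ⊢
      rw [hzt, ← h2]
      module
  rcases le_or_gt t 1 with h1 | h1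
  · exact key hx.1 hy.1 hz.1 hxz hyz h0.le h1 hzt
  · refine key (t := 1 / t) hx.1 hz.1 hy.1 hxy hyz.symm (by positivity) ?_ ?_
    · exact (div_le_one (by linarith)).2 (by linarith)
    · have h1 : 1 / t * t = 1 := one_div_mul_cancel (by linarith)
      have h2 := congrArg (fun r : ℝ => r • (x - y)) h1
      rw [← sub_eq_zero] at h2 ⊢
      rw [hzt, ← h2]
      module

theorem card_le_four_of_two_lines {Y : Finset Plane}
    (hY : ConvexIndependent ℝ (Subtype.val : ↥(Y : Set Plane) → Plane)) {f g : Plane →L[ℝ] ℝ}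
    (hf : f ≠ 0) (hg : g ≠ 0) {s t : ℝ} (h : ∀ p ∈ Y, f p = s ∨ g p = t) : Y.card ≤ 4 := by
  classical
  have hsub : Y ⊆ (Y.filter fun p => f p = s) ∪ Y.filter fun p => g p = t := by
    intro p hp
    simpa [hp] using h p hp
  have h1 := card_filter_apply_eq_le hY hf s
  have h2 := card_filter_apply_eq_le hY hg t
  have h3 := Finset.card_le_card hsub
  have h4 := Finset.card_union_le (Y.filter fun p => f p = s) (Y.filter fun p => g p = t)
  omega

section Coordinates

variable {f g : Plane →L[ℝ] ℝ}

theorem left_ne_zero_of_dualDet_ne_zero (h : dualDet f g ≠ 0) : f ≠ 0 := by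
  rintro rfl; simp [dualDet] at h

theorem right_ne_zero_of_dualDet_ne_zero (h : dualDet f g ≠ 0) : g ≠ 0 := by
  rintro rfl; simp [dualDet] at h

theorem comb_ne_zero_of_dualDet_ne_zero (h : dualDet f g ≠ 0) {a b : ℝ} (hab : a ≠ 0 ∨ b ≠ 0) :
    a • f + b • g ≠ 0 := by
  intro h0
  obtain ⟨x, hx, hx'⟩ := exists_apply_eq_of_dualDet_ne_zero h 1 0
  obtain ⟨y, hy, hy'⟩ := exists_apply_eq_of_dualDet_ne_zero h 0 1
  have h1 := DFunLike.congr_fun h0 x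
  have h2 := DFunLike.congr_fun h0 y
  simp [hx, hx', hy, hy'] at h1 h2
  tauto

theorem ext_of_dualDet_ne_zero (h : dualDet f g ≠ 0) {x y : Plane} (hf : f x = f y)
    (hg : g x = g y) : x = y := by
  have key : ∀ u : Plane →L[ℝ] ℝ, u x = u y := fun u => by
    obtain ⟨r, s, rfl⟩ := exists_eq_comb_of_dualDet_ne_zero h u
    simp [hf, hg]
  ext i
  exact key (EuclideanSpace.proj i)

theorem isBounded_of_dualDet_ne_zero (h : dualDet f g ≠ 0) {S : Set Plane} {R : ℝ}
    (hf : ∀ x ∈ S, |f x| ≤ R) (hg : ∀ x ∈ S, |g x| ≤ R) : Bornology.IsBounded S := by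
  have key : ∀ u : Plane →L[ℝ] ℝ, ∃ C, ∀ x ∈ S, |u x| ≤ C := fun u => by
    obtain ⟨r, s, rfl⟩ := exists_eq_comb_of_dualDet_ne_zero h u
    refine ⟨|r| * R + |s| * R, fun x hx => ?_⟩
    simp only [_root_.add_apply, _root_.smul_apply, smul_eq_mul]
    refine (abs_add_le _ _).trans ?_
    rw [abs_mul, abs_mul]
    gcongr
    exacts [hf x hx, hg x hx]
  obtain ⟨C, hC⟩ := key (EuclideanSpace.proj 0)
  obtain ⟨D, hD⟩ := key (EuclideanSpace.proj 1)
  refine isBounded_iff_forall_norm_le.2 ⟨√(C ^ 2 + D ^ 2), fun x hx => ?_⟩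
  rw [EuclideanSpace.norm_eq, Fin.sum_univ_two]
  refine Real.sqrt_le_sqrt (add_le_add ?_ ?_) <;> refine pow_le_pow_left₀ (norm_nonneg _) ?_ 2
  · exact hC x hx
  · exact hD x hx

end Coordinates

/-! ### Symmetric bodies through points of a conic -/

theorem setOf_lt_subset_setOf_le (u v : Plane → ℝ) : {x | u x < v x} ⊆ {x | u x ≤ v x} := by
  intro x hx
  simp only [Set.mem_ofPred_eq] at hx ⊢
  exact hx.le

theorem inCSCPosition_of_support {Y K : Set Plane} (hK : IsClosed K) (hb : Bornology.IsBounded K)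
    (hconv : Convex ℝ K) {o : Plane} (ho : ∀ x ∈ K, (2 : ℝ) • o - x ∈ K) {U : Set Plane}
    (hU : IsOpen U) (hUK : U ⊆ K) (hUne : U.Nonempty) (hYK : Y ⊆ K)
    (hY : ∀ y ∈ Y, ∃ g : Plane →L[ℝ] ℝ, g ≠ 0 ∧ ∀ x ∈ K, g x ≤ g y) : InCSCPosition Y :=
  ⟨K, ⟨Metric.isCompact_of_isClosed_isBounded hK hb, hconv,
    hUne.mono (interior_maximal hUK hU), o, ho⟩, fun y hy =>
    let ⟨_, hg, hgK⟩ := hY y hy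
    mem_frontier_of_support (hYK hy) hg hgK⟩

theorem inCSCPosition_of_ellipse {f g : Plane →L[ℝ] ℝ} (hdet : dualDet f g ≠ 0) {s t C : ℝ}
    {Y : Set Plane} (hY : Y.Nontrivial) (h : ∀ p ∈ Y, (f p + s) ^ 2 + (g p + t) ^ 2 = C) :
    InCSCPosition Y := by
  have hC : 0 < C := by
    obtain ⟨x, hx, y, hy, hxy⟩ := hY
    by_contra! hC
    have key : ∀ p ∈ Y, f p = -s ∧ g p = -t := fun p hp => by
      have h1 := h p hp
      constructor <;> nlinarith [sq_nonneg (f p + s), sq_nonneg (g p + t)]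
    exact hxy (ext_of_dualDet_ne_zero hdet ((key x hx).1.trans (key y hy).1.symm)
      ((key x hx).2.trans (key y hy).2.symm))
  obtain ⟨o, hfo, hgo⟩ := exists_apply_eq_of_dualDet_ne_zero hdet (-s) (-t)
  have hsq : ∀ x, (f x + s) ^ 2 + (g x + t) ^ 2 ≤ C →
      |f x| ≤ C + 1 + |s| + |t| ∧ |g x| ≤ C + 1 + |s| + |t| := by
    intro x hx
    have key : ∀ {a b c : ℝ}, (a + b) ^ 2 + c ^ 2 ≤ C → |a| ≤ C + 1 + |b| := by
      intro a b c habc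
      have h1 : |a + b| ≤ C + 1 := abs_le_of_sq_le_sq (by nlinarith [sq_nonneg c]) (by linarith)
      have h2 := abs_sub_abs_le_abs_sub a (-b)
      rw [abs_neg, sub_neg_eq_add] at h2
      linarith
    have h1 := key hx
    have h2 := key (a := g x) (b := t) (c := f x + s) (by linarith)
    have h3 := abs_nonneg s
    have h4 := abs_nonneg t
    constructor <;> linarith
  refine inCSCPosition_of_support (K := {x | (f x + s) ^ 2 + (g x + t) ^ 2 ≤ C}) (o := o)
    (U := {x | (f x + s) ^ 2 + (g x + t) ^ 2 < C})
    (isClosed_le (by fun_prop) (by fun_prop))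
    (isBounded_of_dualDet_ne_zero hdet (fun x hx => (hsq x hx).1) (fun x hx => (hsq x hx).2))
    ?_ (fun x hx => ?_) (isOpen_lt (by fun_prop) (by fun_prop)) (setOf_lt_subset_setOf_le _ _)
    ⟨o, by simpa [hfo, hgo] using hC⟩ (fun p hp => (h p hp).le) (fun p hp => ?_)
  · intro x hx y hy a b ha hb hab
    simp only [Set.mem_ofPred_eq, map_add, map_smul, smul_eq_mul] at hx hy ⊢
    obtain rfl : b = 1 - a := by linarith
    nlinarith [mul_nonneg (mul_nonneg ha hb) (sq_nonneg (f x - f y)),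
      mul_nonneg (mul_nonneg ha hb) (sq_nonneg (g x - g y)),
      mul_le_mul_of_nonneg_left hx ha, mul_le_mul_of_nonneg_left hy hb]
  · simp only [Set.mem_ofPred_eq, map_sub, map_smul, smul_eq_mul, hfo, hgo] at hx ⊢
    linarith
  · have hp' := h p hp
    refine ⟨(f p + s) • f + (g p + t) • g, comb_ne_zero_of_dualDet_ne_zero hdet ?_,
      fun x hx => ?_⟩
    · by_contra! h0
      rw [h0.1, h0.2] at hp'
      linarith
    · simp only [Set.mem_ofPred_eq, _root_.add_apply, _root_.smul_apply, smul_eq_mul] at hx ⊢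
      nlinarith [sq_nonneg (f x - f p), sq_nonneg (g x - g p)]

/-- The body is the parabolic region met with its reflection in the midpoint of the extreme points
`p`, `q`. A point `x` of `Y` lies in the reflected region because `(f x - f p) * (f q - f x) ≥ 0`,
and the tangent of the parabola at `x` supports the lens. -/
theorem inCSCPosition_of_parabola {f g : Plane →L[ℝ] ℝ} (hdet : dualDet f g ≠ 0) {t : ℝ}
    {Y : Finset Plane} (hY : (Y : Set Plane).Nontrivial) (h : ∀ p ∈ Y, g p + t = f p ^ 2) :
    InCSCPosition (Y : Set Plane) := by
  obtain ⟨p, hp, hpmin⟩ := Y.exists_min_image f (Finset.coe_nonempty.1 hY.nonempty)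
  obtain ⟨q, hq, hqmax⟩ := Y.exists_max_image f (Finset.coe_nonempty.1 hY.nonempty)
  have hp' := h p hp
  have hq' := h q hq
  have hpq : f p < f q := by
    obtain ⟨x, hx, y, hy, hxy⟩ := hY
    refine lt_of_le_of_ne (hpmin q hq) fun he => hxy ?_
    have hx1 := hpmin x hx
    have hx2 := hqmax x hx
    have hy1 := hpmin y hy
    have hy2 := hqmax y hy
    have hf : f x = f y := by linarith
    refine ext_of_dualDet_ne_zero hdet hf ?_
    have h1 := h x hx
    have h2 := h y hy
    rw [hf] at h1
    linarith
  refine inCSCPosition_of_support (o := (1 / 2 : ℝ) • (p + q))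
    (K := {x | f x ^ 2 ≤ g x + t} ∩ {x | (f p + f q - f x) ^ 2 ≤ g p + g q - g x + t})
    (U := {x | f x ^ 2 < g x + t} ∩ {x | (f p + f q - f x) ^ 2 < g p + g q - g x + t})
    ((isClosed_le (by fun_prop) (by fun_prop)).inter (isClosed_le (by fun_prop) (by fun_prop)))
    (isBounded_of_dualDet_ne_zero hdet (R := |g p| + |g q| + 3 * |t| + 1)
      (fun x hx => ?_) (fun x hx => ?_)) ?_ (fun x hx => ?_)
    ((isOpen_lt (by fun_prop) (by fun_prop)).inter (isOpen_lt (by fun_prop) (by fun_prop)))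
    (Set.inter_subset_inter (setOf_lt_subset_setOf_le _ _) (setOf_lt_subset_setOf_le _ _))
    ⟨(1 / 2 : ℝ) • (p + q), ?_⟩ (fun x hx => ?_) (fun x hx => ?_)
  · obtain ⟨h1, h2⟩ := hx
    simp only [Set.mem_ofPred_eq] at h1 h2
    have := le_abs_self (g p)
    have := le_abs_self (g q)
    have := le_abs_self t
    have := abs_nonneg (g p)
    have := abs_nonneg (g q)
    have := abs_nonneg t
    have : f x ^ 2 ≤ |g p| + |g q| + 3 * |t| := by nlinarith [sq_nonneg (f p + f q - f x)]
    exact abs_le_of_sq_le_sq (by nlinarith) (by linarith)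
  · obtain ⟨h1, h2⟩ := hx
    simp only [Set.mem_ofPred_eq] at h1 h2
    have := le_abs_self (g p)
    have := le_abs_self (g q)
    have := le_abs_self t
    have := abs_nonneg (g p)
    have := abs_nonneg (g q)
    have := abs_nonneg t
    rw [abs_le]
    constructor <;> nlinarith [sq_nonneg (f p + f q - f x), sq_nonneg (f x)]
  · rintro x ⟨hx1, hx2⟩ y ⟨hy1, hy2⟩ a b ha hb hab
    simp only [Set.mem_inter_iff, Set.mem_ofPred_eq, map_add, map_smul, smul_eq_mul] at *
    obtain rfl : b = 1 - a := by linarith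
    have h0 := mul_nonneg (mul_nonneg ha hb) (sq_nonneg (f x - f y))
    constructor
    · linarith [mul_le_mul_of_nonneg_left hx1 ha, mul_le_mul_of_nonneg_left hy1 hb]
    · linarith [mul_le_mul_of_nonneg_left hx2 ha, mul_le_mul_of_nonneg_left hy2 hb]
  · obtain ⟨h1, h2⟩ := hx
    simp only [Set.mem_inter_iff, Set.mem_ofPred_eq, map_add, map_sub, map_smul,
      smul_eq_mul] at *
    constructor <;> linarith
  · have := mul_pos (sub_pos.2 hpq) (sub_pos.2 hpq)
    simp only [Set.mem_inter_iff, Set.mem_ofPred_eq, map_add, map_smul, smul_eq_mul]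
    constructor <;> linarith
  · have h1 := mul_nonneg (sub_nonneg.2 (hpmin x hx)) (sub_nonneg.2 (hqmax x hx))
    have hx' := h x hx
    simp only [Set.mem_inter_iff, Set.mem_ofPred_eq]
    constructor <;> linarith
  · have hx' := h x hx
    refine ⟨(2 * f x) • f + (-1 : ℝ) • g, comb_ne_zero_of_dualDet_ne_zero hdet (by norm_num),
      fun y hy => ?_⟩
    have h1 := hy.1
    simp only [Set.mem_ofPred_eq, _root_.add_apply, _root_.smul_apply, smul_eq_mul] at h1 ⊢
    linarith [sq_nonneg (f y - f x)]

/-- AM–GM; this is the tangent line of the hyperbola at `(u, v)`. -/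
theorem mul_add_mul_ge_of_mul_eq {C u v x y : ℝ} (hu : 0 < u) (hv : 0 < v) (huv : u * v = C)
    (hx : 0 ≤ x) (hy : 0 ≤ y) (hxy : C ≤ x * y) : 2 * C ≤ v * x + u * y := by
  have hC : 0 < C := huv ▸ mul_pos hu hv
  refine (sq_le_sq₀ (by positivity) (by positivity)).1 ?_
  nlinarith [sq_nonneg (v * x - u * y), mul_le_mul_of_nonneg_left hxy hC.le]

theorem mul_combo_ge {C x y x' y' a b : ℝ} (hC : 0 ≤ C) (hx : 0 ≤ x) (hy : 0 ≤ y) (hx' : 0 ≤ x')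
    (hy' : 0 ≤ y') (h : C ≤ x * y) (h' : C ≤ x' * y') (ha : 0 ≤ a) (hb : 0 ≤ b)
    (hab : a + b = 1) : C ≤ (a * x + b * x') * (a * y + b * y') := by
  have hcross : 2 * C ≤ x * y' + x' * y := by
    refine (sq_le_sq₀ (by positivity) (by positivity)).1 ?_
    nlinarith [sq_nonneg (x * y' - x' * y), mul_le_mul h h' hC (by positivity)]
  obtain rfl : b = 1 - a := by linarith
  nlinarith [mul_le_mul_of_nonneg_left h (mul_nonneg ha ha),
    mul_le_mul_of_nonneg_left h' (mul_nonneg hb hb),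
    mul_le_mul_of_nonneg_left hcross (mul_nonneg ha hb)]

theorem inCSCPosition_of_hyperbola_branch {f g : Plane →L[ℝ] ℝ} (hdet : dualDet f g ≠ 0)
    {s t C : ℝ} (hC : 0 < C) {Y : Finset Plane} (hY : (Y : Set Plane).Nontrivial)
    (hpos : ∀ p ∈ Y, 0 < f p + s) (h : ∀ p ∈ Y, (f p + s) * (g p + t) = C) :
    InCSCPosition (Y : Set Plane) := by
  have hpos' : ∀ p ∈ Y, 0 < g p + t := fun p hp =>
    (mul_pos_iff_of_pos_left (hpos p hp)).1 ((h p hp).symm ▸ hC)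
  obtain ⟨p, hp, hpmin⟩ := Y.exists_min_image f (Finset.coe_nonempty.1 hY.nonempty)
  obtain ⟨q, hq, hqmax⟩ := Y.exists_max_image f (Finset.coe_nonempty.1 hY.nonempty)
  have hpq : f p < f q := by
    obtain ⟨x, hx, y, hy, hxy⟩ := hY
    refine lt_of_le_of_ne (hpmin q hq) fun he => hxy ?_
    have hx1 := hpmin x hx
    have hx2 := hqmax x hx
    have hy1 := hpmin y hy
    have hy2 := hqmax y hy
    have hf : f x = f y := by linarith
    refine ext_of_dualDet_ne_zero hdet hf ?_
    have h1 := h x hx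
    rw [← h y hy, hf] at h1
    linarith [mul_left_cancel₀ (hpos y hy).ne' h1]
  set S : Set Plane := {x | 0 ≤ f x + s} ∩ ({x | 0 ≤ g x + t} ∩
    {x | C ≤ (f x + s) * (g x + t)}) with hS
  set V : Set Plane := {x | 0 < f x + s} ∩ ({x | 0 < g x + t} ∩
    {x | C < (f x + s) * (g x + t)}) with hV
  have hSmem : ∀ x, x ∈ S ↔ 0 ≤ f x + s ∧ 0 ≤ g x + t ∧ C ≤ (f x + s) * (g x + t) :=
    fun x => Iff.rfl
  have hVmem : ∀ x, x ∈ V ↔ 0 < f x + s ∧ 0 < g x + t ∧ C < (f x + s) * (g x + t) :=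
    fun x => Iff.rfl
  have hVS : V ⊆ S := fun x hx =>
    (hSmem x).2 ⟨hx.1.le, hx.2.1.le, ((hVmem x).1 hx).2.2.le⟩
  have hSc : IsClosed S := (isClosed_le (by fun_prop) (by fun_prop)).inter
    ((isClosed_le (by fun_prop) (by fun_prop)).inter (isClosed_le (by fun_prop) (by fun_prop)))
  have hVo : IsOpen V := (isOpen_lt (by fun_prop) (by fun_prop)).inter
    ((isOpen_lt (by fun_prop) (by fun_prop)).inter (isOpen_lt (by fun_prop) (by fun_prop)))
  have hSconv : Convex ℝ S := by
    intro x hx y hy a b ha hb hab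
    rw [hSmem] at hx hy ⊢
    have hf : f (a • x + b • y) + s = a * (f x + s) + b * (f y + s) := by
      simp only [map_add, map_smul, smul_eq_mul]; linear_combination -s * hab
    have hg : g (a • x + b • y) + t = a * (g x + t) + b * (g y + t) := by
      simp only [map_add, map_smul, smul_eq_mul]; linear_combination -t * hab
    rw [hf, hg]
    refine ⟨add_nonneg (mul_nonneg ha hx.1) (mul_nonneg hb hy.1),
      add_nonneg (mul_nonneg ha hx.2.1) (mul_nonneg hb hy.2.1), ?_⟩
    exact mul_combo_ge hC.le hx.1 hx.2.1 hy.1 hy.2.1 hx.2.2 hy.2.2 ha hb hab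
  have hYS : ∀ x ∈ Y, x ∈ S := fun x hx => ⟨(hpos x hx).le, (hpos' x hx).le, (h x hx).ge⟩
  have hcont : Continuous fun x : Plane => p + q - x := by fun_prop
  have hgp := hpos' p hp
  have hgq := hpos' q hq
  have hfp := hpos p hp
  have hfq := hpos q hq
  have hp' := h p hp
  have hq' := h q hq
  have hrefl : ∀ x ∈ Y, p + q - x ∈ S := fun x hx => by
    have h1 := hpmin x hx
    have h2 := hqmax x hx
    have hx' := h x hx
    have hfx := hpos x hx
    have hgx := hpos' x hx
    have hanti : ∀ y ∈ Y, ∀ z ∈ Y, f y ≤ f z → g z ≤ g y := fun y hy z hz hyz => by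
      by_contra! hlt
      have := mul_lt_mul' (add_le_add_left hyz s) (add_lt_add_left hlt t) (hpos' y hy).le
        (hpos z hz)
      rw [h y hy, h z hz] at this
      exact lt_irrefl _ this
    have h3 := hanti p hp x hx h1
    have h4 := hanti x hx q hq h2
    rw [hSmem]
    simp only [map_add, map_sub]
    refine ⟨by linarith, by linarith, ?_⟩
    set u := f x + s
    set a := f p + s
    set b := f q + s
    have hu : f p + f q - f x + s = a + b - u := by simp only [u, a, b]; ring
    have hv : g p + g q - g x + t = C / a + C / b - C / u := by
      rw [← h x hx, mul_div_cancel_left₀ _ hfx.ne', h x hx, ← h p hp,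
        mul_div_cancel_left₀ _ hfp.ne', h p hp, ← h q hq, mul_div_cancel_left₀ _ hfq.ne']
      ring
    -- The sign of this factorisation shows that the branch between `p` and `q` lies in the
    -- reflected region.
    have hdiff : (a + b - u) * (C / a + C / b - C / u) - C =
        C * (a + b) * ((u - a) * (b - u)) / (a * b * u) := by
      field_simp
      ring
    have hnn : 0 ≤ C * (a + b) * ((u - a) * (b - u)) / (a * b * u) := by
      have h5 : 0 ≤ u - a := by simp only [u, a]; linarith
      have h6 : 0 ≤ b - u := by simp only [u, b]; linarith
      positivity
    rw [hu, hv]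
    linarith
  refine inCSCPosition_of_support (o := (1 / 2 : ℝ) • (p + q))
    (K := S ∩ (fun x => p + q - x) ⁻¹' S) (U := V ∩ (fun x => p + q - x) ⁻¹' V)
    (hSc.inter (hSc.preimage hcont))
    (isBounded_of_dualDet_ne_zero hdet
      (R := |f p| + |f q| + |s| + |g p| + |g q| + |t|)
      (fun x hx => ?_) (fun x hx => ?_)) ?_ (fun x hx => ?_)
    (hVo.inter (hVo.preimage hcont)) (Set.inter_subset_inter hVS (Set.preimage_mono hVS))
    ⟨(1 / 2 : ℝ) • (p + q), ?_⟩ (fun x hx => ⟨hYS x hx, hrefl x hx⟩) (fun x hx => ?_)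
  · obtain ⟨⟨h1, h2, -⟩, h3, h4, -⟩ := hx
    simp only [Set.mem_ofPred_eq, map_add, map_sub] at h1 h3
    have := le_abs_self (f p)
    have := le_abs_self (f q)
    have := le_abs_self s
    have := abs_nonneg (f p)
    have := abs_nonneg (f q)
    have := abs_nonneg (g p)
    have := abs_nonneg (g q)
    have := abs_nonneg t
    rw [abs_le]
    constructor <;> linarith
  · obtain ⟨⟨h1, h2, -⟩, h3, h4, -⟩ := hx
    simp only [Set.mem_ofPred_eq, map_add, map_sub] at h2 h4
    have := le_abs_self (g p)
    have := le_abs_self (g q)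
    have := le_abs_self t
    have := abs_nonneg (f p)
    have := abs_nonneg (f q)
    have := abs_nonneg (g p)
    have := abs_nonneg (g q)
    have := abs_nonneg s
    rw [abs_le]
    constructor <;> linarith
  · refine hSconv.inter ?_
    intro x hx y hy a b ha hb hab
    have := hSconv hx hy ha hb hab
    have he : a • (p + q - x) + b • (p + q - y) = p + q - (a • x + b • y) := by
      obtain rfl : b = 1 - a := by linarith
      module
    rw [he] at this
    exact this
  · have he : (2 : ℝ) • (1 / 2 : ℝ) • (p + q) - x = p + q - x := by module
    rw [he]
    exact ⟨hx.2, by simpa using hx.1⟩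
  · have he : p + q - (1 / 2 : ℝ) • (p + q) = (1 / 2 : ℝ) • (p + q) := by module
    have hmem : (1 / 2 : ℝ) • (p + q) ∈ V := by
      rw [hVmem]
      simp only [map_smul, map_add, smul_eq_mul]
      refine ⟨by linarith, by linarith, ?_⟩
      set u := f p + s
      set v := g p + t
      set u' := f q + s
      set v' := g q + t
      have e1 : 1 / 2 * (f p + f q) + s = (u + u') / 2 := by simp only [u, u']; ring
      have e2 : 1 / 2 * (g p + g q) + t = (v + v') / 2 := by simp only [v, v']; ring
      rw [e1, e2]
      have h5 : 0 < u' - u := by simp only [u, u']; linarith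
      have h6 : 0 < (u' - u) * (v - v') := by
        refine mul_pos h5 ?_
        by_contra! hle
        nlinarith
      linarith
    exact ⟨hmem, by simpa only [Set.mem_preimage, he] using hmem⟩
  · have hfx := hpos x hx
    have hgx := hpos' x hx
    refine ⟨(-(g x + t)) • f + (-(f x + s)) • g, comb_ne_zero_of_dualDet_ne_zero hdet
      (Or.inl (by linarith)), fun y hy => ?_⟩
    have h1 := mul_add_mul_ge_of_mul_eq hfx hgx (h x hx) hy.1.1 hy.1.2.1 hy.1.2.2
    have h2 := h x hx
    simp only [_root_.add_apply, _root_.smul_apply, smul_eq_mul]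
    linarith

/-- Of three points on one branch, the middle one is in the triangle formed by the outer two and any
point of the other branch. -/
theorem forall_pos_of_two_lt_card_filter_pos {f g : Plane →L[ℝ] ℝ} (hdet : dualDet f g ≠ 0)
    {s t C : ℝ} (hC : 0 < C) {Y : Finset Plane}
    (hY : ConvexIndependent ℝ (Subtype.val : ↥(Y : Set Plane) → Plane))
    (h : ∀ p ∈ Y, (f p + s) * (g p + t) = C) (hcard : 2 < (Y.filter fun p => 0 < f p + s).card) :
    ∀ p ∈ Y, 0 < f p + s := by
  rw [convexIndependent_set_iff_notMem_convexHull_sdiff] at hY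
  intro x hx
  by_contra! hx0
  have hxne : f x + s ≠ 0 := fun h0 => by
    have := h x hx
    rw [h0, zero_mul] at this
    exact hC.ne this
  have hneg : f x + s < 0 := lt_of_le_of_ne hx0 hxne
  have hg : ∀ p ∈ Y, g p + t = C / (f p + s) := fun p hp => by
    have hne : f p + s ≠ 0 := fun h0 => by
      have := h p hp
      rw [h0, zero_mul] at this
      exact hC.ne this
    rw [eq_div_iff hne, mul_comm]; exact h p hp
  have key : ∀ {p q r : Plane}, p ∈ Y → q ∈ Y → r ∈ Y → 0 < f p + s → f p < f q → f q < f r →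
      False := by
    intro p q r hp hq hr hp0 hpq hqr
    refine hY q hq ?_
    have hconv := convex_convexHull ℝ ((Y : Set Plane) \ {q})
    have hne : ∀ z ∈ Y, f z ≠ f q → z ∈ convexHull ℝ ((Y : Set Plane) \ {q}) := fun z hz hzq =>
      subset_convexHull ℝ _ ⟨hz, fun he => hzq (by rw [Set.mem_singleton_iff.1 he])⟩
    have hp' := hne p hp hpq.ne
    have hr' := hne r hr hqr.ne'
    have hx' := hne x hx (by linarith)
    have gp := hg p hp
    have gq := hg q hq
    have gr := hg r hr
    have gx := hg x hx
    obtain ⟨a, ha⟩ : ∃ a, a = f p + s := ⟨_, rfl⟩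
    obtain ⟨b, hb⟩ : ∃ b, b = f q + s := ⟨_, rfl⟩
    obtain ⟨c, hc⟩ : ∃ c, c = f r + s := ⟨_, rfl⟩
    obtain ⟨m, hm⟩ : ∃ m, m = -(f x + s) := ⟨_, rfl⟩
    have hxm : f x + s = -m := by linarith
    rw [← ha] at gp hp0
    rw [← hb] at gq
    rw [← hc] at gr
    rw [hxm] at gx hneg
    have hm0 : 0 < m := by linarith
    have hab : 0 < b - a := by linarith
    have hbc : 0 < c - b := by linarith
    have hb0 : 0 < b := by linarith
    have hc0 : 0 < c := by linarith
    have hac : 0 < c - a := by linarith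
    -- Barycentric coordinates of `q` with respect to `p`, `r`, `x`; nonnegative since `0 < a < b <
    -- c` and `0 < m`.
    set w₁ := a * (c - b) * (b + m) / (b * (c - a) * (a + m)) with hw₁
    set w₂ := c * (b - a) * (b + m) / (b * (c - a) * (c + m)) with hw₂
    set w₃ := m * (c - b) * (b - a) / (b * (c + m) * (a + m)) with hw₃
    have hw₁0 : 0 ≤ w₁ := by positivity
    have hw₂0 : 0 ≤ w₂ := by positivity
    have hw₃0 : 0 ≤ w₃ := by positivity
    have ham : a + m ≠ 0 := by positivity
    have hcm : c + m ≠ 0 := by positivity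
    have hsum : w₁ + w₂ + w₃ = 1 := by
      rw [hw₁, hw₂, hw₃]; field_simp; ring
    have hfsum : w₁ * a + w₂ * c - w₃ * m = b := by
      rw [hw₁, hw₂, hw₃]; field_simp; ring
    have hgsum : w₁ * (C / a) + w₂ * (C / c) + w₃ * (C / -m) = C / b := by
      rw [hw₁, hw₂, hw₃, div_neg]; field_simp; ring
    have hq' : q = w₁ • p + w₂ • r + w₃ • x := by
      apply ext_of_dualDet_ne_zero hdet
      · simp only [map_add, map_smul, smul_eq_mul]
        linear_combination -hb - hfsum + w₁ * ha + w₂ * hc - w₃ * hm + s * hsum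
      · simp only [map_add, map_smul, smul_eq_mul]
        linear_combination gq - hgsum - w₁ * gp - w₂ * gr - w₃ * gx + t * hsum
    have hmem := hconv.sum_mem (t := Finset.univ) (w := ![w₁, w₂, w₃]) (z := ![p, r, x])
      (by intro i _; fin_cases i <;> assumption)
      (by simpa [Fin.sum_univ_three] using hsum)
      (by intro i _; fin_cases i <;> assumption)
    simp only [Fin.sum_univ_three, Matrix.cons_val] at hmem
    rwa [← hq'] at hmem
  obtain ⟨p, hp, q, hq, r, hr, hpq, hpr, hqr⟩ := Finset.two_lt_card.1 hcard
  rw [Finset.mem_filter] at hp hq hr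
  have hinj : ∀ y ∈ Y, ∀ z ∈ Y, y ≠ z → f y ≠ f z := fun y hy z hz hyz hf => by
    refine hyz (ext_of_dualDet_ne_zero hdet hf ?_)
    have h1 := hg y hy
    rw [hf, ← hg z hz] at h1
    linarith
  rcases (hinj p hp.1 q hq.1 hpq).lt_or_gt with h1 | h1 <;>
  rcases (hinj q hq.1 r hr.1 hqr).lt_or_gt with h2 | h2 <;>
  rcases (hinj p hp.1 r hr.1 hpr).lt_or_gt with h3 | h3
  · exact key hp.1 hq.1 hr.1 hp.2 h1 h2
  · linarith
  · exact key hp.1 hr.1 hq.1 hp.2 h3 h2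
  · exact key hr.1 hp.1 hq.1 hr.2 h3 h1
  · exact key hq.1 hp.1 hr.1 hq.2 h1 h3
  · exact key hq.1 hr.1 hp.1 hq.2 h2 h3
  · linarith
  · exact key hr.1 hq.1 hp.1 hr.2 h2 h1

theorem inCSCPosition_of_hyperbola {f g : Plane →L[ℝ] ℝ} (hdet : dualDet f g ≠ 0)
    {s t C : ℝ} {Y : Finset Plane}
    (hY : ConvexIndependent ℝ (Subtype.val : ↥(Y : Set Plane) → Plane)) (hcard : Y.card = 5)
    (h : ∀ p ∈ Y, (f p + s) * (g p + t) = C) : InCSCPosition (Y : Set Plane) := by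
  wlog hC : 0 ≤ C generalizing f s C
  · refine this (f := -f) (s := -s) (C := -C) ?_ (fun p hp => ?_) (by linarith)
    · have : dualDet (-f) g = -dualDet f g := by simp [dualDet]; ring
      rw [this]; exact neg_ne_zero.2 hdet
    · rw [_root_.neg_apply]; linarith [h p hp]
  rcases hC.eq_or_lt with rfl | hC
  · exfalso
    have := card_le_four_of_two_lines hY (left_ne_zero_of_dualDet_ne_zero hdet)
      (right_ne_zero_of_dualDet_ne_zero hdet) (s := -s) (t := -t) fun p hp => by
        rcases mul_eq_zero.1 (h p hp) with h0 | h0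
        · exact Or.inl (by linarith)
        · exact Or.inr (by linarith)
    omega
  -- Negating both factors swaps the branches and keeps `C`; one branch carries at least three of
  -- the five points.
  wlog hmaj : 2 < (Y.filter fun p => 0 < f p + s).card generalizing f g s t
  · refine this (f := -f) (g := -g) (s := -s) (t := -t) ?_ (fun p hp => ?_) ?_
    · have : dualDet (-f) (-g) = dualDet f g := by simp [dualDet]
      rwa [this]
    · rw [_root_.neg_apply, _root_.neg_apply]; linarith [h p hp]
    · have h1 := Y.card_filter_add_card_filter_not (fun p => 0 < f p + s)
      have h2 : Y.filter (fun p => ¬ 0 < f p + s) ⊆ Y.filter fun p => 0 < (-f) p + -s := by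
        intro p hp
        rw [Finset.mem_filter] at hp ⊢
        refine ⟨hp.1, ?_⟩
        have hne : f p + s ≠ 0 := fun h0 => by
          have := h p hp.1
          rw [h0, zero_mul] at this
          exact hC.ne this
        have := lt_of_le_of_ne (not_lt.1 hp.2) hne
        rw [_root_.neg_apply]; linarith
      have h3 := Finset.card_le_card h2
      omega
  have hnt : (Y : Set Plane).Nontrivial := Finset.one_lt_card_iff_nontrivial.1 (by omega)
  exact inCSCPosition_of_hyperbola_branch hdet hC hnt
    (forall_pos_of_two_lt_card_filter_pos hdet hC hY h hmaj) h

/-- Any five points in strictly convex position lie on the boundary of a centrally symmetric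
convex body. -/
theorem ConvexIndependent.inCSCPosition {Y : Finset Plane}
    (hY : ConvexIndependent ℝ (Subtype.val : ↥(Y : Set Plane) → Plane)) (hcard : Y.card = 5) :
    InCSCPosition (Y : Set Plane) := by
  obtain ⟨a, b, c, d, e, k, h0, hq⟩ := exists_conic hcard
  have hnt : (Y : Set Plane).Nontrivial := Finset.one_lt_card_iff_nontrivial.1 (by omega)
  rcases conic_normal_form (Y := (Y : Set Plane)) h0 hq hnt.nonempty with
    ⟨f, s₁, s₂, hf, h⟩ | ⟨f, g, s, t, C, hdet, h | h | h⟩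
  · have := card_le_four_of_two_lines hY hf hf h
    omega
  · exact inCSCPosition_of_ellipse hdet hnt h
  · exact inCSCPosition_of_hyperbola hdet hY hcard h
  · exact inCSCPosition_of_parabola hdet hnt h

/-! ### A strictly convex curve without a centre -/

/-- The union of the upper half of the unit circle and the lower half of the ellipse
`x ^ 2 + 4 * y ^ 2 = 1`. -/
def halfEllipseCurve : Set Plane :=
  Set.range fun z : Circle => !₂[(z : ℂ).re, max (z : ℂ).im ((z : ℂ).im / 2)]

theorem mem_halfEllipseCurve {p : Plane} : p ∈ halfEllipseCurve ↔
    0 ≤ p 1 ∧ p 0 ^ 2 + p 1 ^ 2 = 1 ∨ p 1 < 0 ∧ p 0 ^ 2 + 4 * p 1 ^ 2 = 1 := by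
  have hz : ∀ z : Circle, (z : ℂ).re ^ 2 + (z : ℂ).im ^ 2 = 1 := fun z => by
    have h := Circle.normSq_coe z
    rw [Complex.normSq_apply] at h
    linarith
  constructor
  · rintro ⟨z, rfl⟩
    have h := hz z
    rcases le_or_gt 0 (z : ℂ).im with h0 | h0
    · left
      have hm : max (z : ℂ).im ((z : ℂ).im / 2) = (z : ℂ).im := max_eq_left (by linarith)
      simpa [hm] using ⟨h0, h⟩
    · right
      have hm : max (z : ℂ).im ((z : ℂ).im / 2) = (z : ℂ).im / 2 := max_eq_right (by linarith)
      simp only [Matrix.cons_val_zero, Matrix.cons_val_one, hm]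
      exact ⟨by linarith, by linarith⟩
  · have key : ∀ x y : ℝ, x ^ 2 + y ^ 2 = 1 → ∃ z : Circle, (z : ℂ) = ⟨x, y⟩ := fun x y hxy =>
      ⟨⟨⟨x, y⟩, mem_sphere_zero_iff_norm.2 (by
        rw [← sq_eq_sq₀ (norm_nonneg _) zero_le_one, ← Complex.normSq_eq_norm_sq,
          Complex.normSq_mk]
        linarith)⟩, rfl⟩
    rintro (⟨h0, h⟩ | ⟨h0, h⟩)
    · obtain ⟨z, hz⟩ := key (p 0) (p 1) h
      refine ⟨z, ?_⟩
      ext i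
      fin_cases i
      · simp [hz]
      · simp [hz]; linarith
    · obtain ⟨z, hz⟩ := key (p 0) (2 * p 1) (by linarith)
      refine ⟨z, ?_⟩
      ext i
      fin_cases i
      · simp [hz]
      · simp [hz]; linarith

theorem isClosedCurve_halfEllipseCurve : IsClosedCurve halfEllipseCurve := by
  refine ⟨_, ?_, ?_, rfl⟩
  · refine (PiLp.continuous_toLp 2 _).comp (continuous_pi fun i => ?_)
    fin_cases i
    · exact Complex.continuous_re.comp continuous_subtype_val
    · exact (Complex.continuous_im.comp continuous_subtype_val).max
        ((Complex.continuous_im.comp continuous_subtype_val).div_const 2)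
  · intro z w hzw
    have h0 := congrArg (fun p : Plane => p 0) hzw
    have h1 := congrArg (fun p : Plane => p 1) hzw
    have hmono : StrictMono fun y : ℝ => max y (y / 2) := by
      intro a b hab
      exact max_lt_max hab (by linarith)
    exact Subtype.ext (Complex.ext (by simpa using h0) (hmono.injective (by simpa using h1)))

/-- At each point the gradient of the conic through it attains its maximum over the curve only
there. -/
theorem convexIndependent_halfEllipseCurve :
    ConvexIndependent ℝ (Subtype.val : ↥halfEllipseCurve → Plane) := by
  rw [convexIndependent_set_iff_notMem_convexHull_sdiff]
  intro p hp hmem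
  obtain ⟨g, hg⟩ : ∃ g : Plane →L[ℝ] ℝ, ∀ q ∈ halfEllipseCurve, q ≠ p → g q < g p := by
    have hne : ∀ q : Plane, q ≠ p → q 0 ≠ p 0 ∨ q 1 ≠ p 1 := fun q hq => by
      by_contra! h
      exact hq (by ext i; fin_cases i; exacts [h.1, h.2])
    rcases mem_halfEllipseCurve.1 hp with ⟨h0, h⟩ | ⟨h0, h⟩
    · refine ⟨Plane.lin (p 0) (p 1), fun q hq hqp => ?_⟩
      have hq1 : q 0 ^ 2 + q 1 ^ 2 ≤ 1 := by
        rcases mem_halfEllipseCurve.1 hq with ⟨h0, h⟩ | ⟨h0, h⟩ <;> nlinarith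
      have hpos : 0 < (q 0 - p 0) ^ 2 + (q 1 - p 1) ^ 2 := by
        rcases hne q hqp with h' | h'
        · have := sub_ne_zero.2 h'; positivity
        · have := sub_ne_zero.2 h'; positivity
      simp only [Plane.lin_apply]
      linarith
    · refine ⟨Plane.lin (p 0) (4 * p 1), fun q hq hqp => ?_⟩
      simp only [Plane.lin_apply]
      rcases mem_halfEllipseCurve.1 hq with ⟨hq0, hq1⟩ | ⟨hq0, hq1⟩
      · have hp1 : 0 < p 1 ^ 2 := by nlinarith
        have := mul_nonneg hq0 (neg_nonneg.2 h0.le)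
        nlinarith [sq_nonneg (q 0 - p 0), sq_nonneg (q 1)]
      · have hpos : 0 < (q 0 - p 0) ^ 2 + 4 * (q 1 - p 1) ^ 2 := by
          rcases hne q hqp with h' | h'
          · have := sub_ne_zero.2 h'; positivity
          · have := sub_ne_zero.2 h'; positivity
        linarith
  have hsub : convexHull ℝ (halfEllipseCurve \ {p}) ⊆ {q | g q < g p} :=
    convexHull_min (fun q hq => hg q hq.1 hq.2) (convex_halfSpace_lt g.isLinear _)
  exact lt_irrefl (g p) (hsub hmem)

theorem IsCSCBody.exists_forall_frontier {K : Set Plane} (hK : IsCSCBody K) :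
    ∃ o : Plane, ∀ x ∈ frontier K, (2 : ℝ) • o - x ∈ frontier K := by
  obtain ⟨-, -, -, o, ho⟩ := hK
  refine ⟨o, fun x hx => ?_⟩
  have hpre : (Homeomorph.subLeft ((2 : ℝ) • o)) ⁻¹' K = K :=
    Set.Subset.antisymm (fun y hy => by simpa using ho _ hy) fun y hy => ho y hy
  have h := (Homeomorph.subLeft ((2 : ℝ) • o)).preimage_frontier K
  rw [hpre] at h
  rw [← h] at hx
  exact hx

theorem not_boundsCSCRegion_halfEllipseCurve : ¬ BoundsCSCRegion halfEllipseCurve := by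
  rintro ⟨K, hK, hΓ⟩
  obtain ⟨o, ho⟩ := hK.exists_forall_frontier
  rw [hΓ] at ho
  have h1 := ho !₂[1, 0] (mem_halfEllipseCurve.2 (by simp))
  have h2 := ho !₂[-1, 0] (mem_halfEllipseCurve.2 (by simp))
  have h3 := ho !₂[0, 1] (mem_halfEllipseCurve.2 (by simp))
  rw [mem_halfEllipseCurve] at h1 h2 h3
  simp only [PiLp.sub_apply, PiLp.smul_apply, smul_eq_mul, Matrix.cons_val_zero,
    Matrix.cons_val_one, sub_zero, sub_neg_eq_add] at h1 h2 h3
  -- The curve lies in the unit disc, and so do the reflections of `(1, 0)` and `(-1, 0)`; adding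
  -- the two bounds forces `o = 0`. But `(0, -1)` is not on the curve.
  have hle : (2 * o 0 - 1) ^ 2 + (2 * o 1) ^ 2 ≤ 1 := by
    rcases h1 with ⟨-, h⟩ | ⟨-, h⟩ <;> nlinarith
  have hle' : (2 * o 0 + 1) ^ 2 + (2 * o 1) ^ 2 ≤ 1 := by
    rcases h2 with ⟨-, h⟩ | ⟨-, h⟩ <;> nlinarith
  have ho0 : o 0 = 0 := by nlinarith [sq_nonneg (o 0), sq_nonneg (o 1)]
  have ho1 : o 1 = 0 := by nlinarith [sq_nonneg (o 0), sq_nonneg (o 1)]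
  rw [ho0, ho1] at h3
  norm_num at h3

theorem theorem2 :
    (∀ Γ : Set Plane, IsClosedCurve Γ → EveryInCSCPosition 6 Γ → BoundsCSCRegion Γ) ∧
    (∀ k : ℕ, k < 6 →
      ∃ Γ : Set Plane, IsClosedCurve Γ ∧ EveryInCSCPosition k Γ ∧ ¬ BoundsCSCRegion Γ) := by
  refine ⟨fun Γ h h6 => h.boundsCSCRegion h6, fun k hk => ⟨halfEllipseCurve,
    isClosedCurve_halfEllipseCurve, fun Y hY hcard => ?_, not_boundsCSCRegion_halfEllipseCurve⟩⟩
  have h5 : EveryInCSCPosition 5 halfEllipseCurve := fun Z hZ hZcard =>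
    (convexIndependent_halfEllipseCurve.mono hZ).inCSCPosition hZcard
  exact h5.of_card_le isClosedCurve_halfEllipseCurve.infinite Y hY (by omega)
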